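/- **Theorem.** Let $d\ge 1$. For $\eta\in\{0,1\}^d$ let $D^\eta f=\Big(\prod_{j:\eta_j=1}\frac{\partial}{\partial x_j}\Big)f$ (so $D^{\mathbf 0}f=f$), and write $\mathbf 0=(0,\dots,0)$, $\mathbf 1=(1,\dots,1)$. A function $f$ on $\mathbb R^d$ belongs to $A(\mathbb R^d)$ if there is $g\in L_1(\mathbb R^d)$ with $f(y)=\int_{\mathbb R^d}g(x)e^{i(x,y)}\,dx$ for all $y\in\mathbb R^d$. Let $f:\mathbb R^d\to\mathbb C$ be continuous with $f(x)\to0$ as $|x|\to\infty$. Suppose that for every $\eta\ne\mathbf 1$ the function $D^\eta f$ is locally absolutely continuous on $(\mathbb R\setminus\{0\})^d$ in each variable, that is, for each $j$ and each choice of nonzero values of the other variables, it is absolutely continuous as a function of $x_j$ on every compact interval not containing $0$. Suppose that $D^\eta f\in L_{p_\eta}(\mathbb R^d)$ for every $\eta\ne\mathbf 0$, where $1<p_\eta<\infty$. (i) If $f\in L_{p_{\mathbf 0}}(\mathbb R^d)$ with $1\le p_{\mathbf 0}<\infty$, and $$\sum_{\mathbf 0\le\eta\le\mathbf 1}\frac1{p_\eta}>2^{d-1},\qquad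 \sum_{\eta\ne\mathbf 0}\frac1{p_\eta}\le 2^{d-1},$$ then $f\in A(\mathbb R^d)$. (ii) (Equivalent form.) If $f\in L_p(\mathbb R^d)$ with $1\le p<p_{\mathbf 0}\le\infty$ (where $1/\infty=0$), and $$\sum_{\mathbf 0\le\eta\le\mathbf 1}\frac1{p_\eta}=2^{d-1},$$ then $f\in A(\mathbb R^d)$. -/

import Mathlib

open MeasureTheory Set Filter Topology
open scoped ENNReal

noncomputable section

/-- `f ∈ A(ℝ^d)`: `f` is the absolutely convergent Fourier integral
`f(y) = ∫ g(x) e^{i(x,y)} dx` of some `g ∈ L_1(ℝ^d)`. Here `ℝ^d` is `Fin d → ℝ` with its product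
topology and Lebesgue measure, and `(x,y) = ∑ x_j y_j`. -/
def InFourierAlgebra {d : ℕ} (f : (Fin d → ℝ) → ℂ) : Prop :=
  ∃ g : (Fin d → ℝ) → ℂ, Integrable g volume ∧
    ∀ y : Fin d → ℝ, f y = ∫ x : Fin d → ℝ, g x * Complex.exp (Complex.I * ((∑ j, x j * y j : ℝ) : ℂ))

/-- `f ∈ C_0(ℝ^d)`: continuous, with limit `0` at infinity. -/
def InC0 {d : ℕ} (f : (Fin d → ℝ) → ℂ) : Prop :=
  Continuous f ∧ Tendsto f (cocompact (Fin d → ℝ)) (𝓝 0)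

/-- The classical partial derivative `∂f/∂x_j`. -/
def partialDeriv {d : ℕ} (j : Fin d) (f : (Fin d → ℝ) → ℂ) : (Fin d → ℝ) → ℂ :=
  fun x => deriv (fun t : ℝ => f (Function.update x j t)) (x j)

/-- `D^η f = (∏_{j : η_j = 1} ∂/∂x_j) f`. The 0-1 vector `η` is given by the set
`{j | η_j = 1}`, so that `∅` is the zero vector and `Finset.univ` the vector `(1,…,1)`.
For `η = {j₁ < ⋯ < j_k}` this is `∂_{j₁} (∂_{j₂} (⋯ (∂_{j_k} f)))`. -/
def mixedDeriv {d : ℕ} (η : Finset (Fin d)) (f : (Fin d → ℝ) → ℂ) : (Fin d → ℝ) → ℂ :=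
  (η.sort (· ≤ ·)).foldr partialDeriv f

theorem mixedDeriv_empty {d : ℕ} (f : (Fin d → ℝ) → ℂ) : mixedDeriv ∅ f = f := by
  simp [mixedDeriv]

/-- `φ` is locally absolutely continuous on `ℝ \ {0}`: absolutely continuous on every compact
interval that does not contain `0`. -/
def LocallyACOffZero (φ : ℝ → ℂ) : Prop :=
  ∀ a b : ℝ, (0 : ℝ) ∉ uIcc a b → AbsolutelyContinuousOnInterval φ a b

/-- `g` is locally absolutely continuous on `(ℝ \ {0})^d` in each variable: for every `j` and all
nonzero values of the other variables, it is so as a function of `x_j ∈ ℝ \ {0}`. -/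
def LocallyACInEachVariable {d : ℕ} (g : (Fin d → ℝ) → ℂ) : Prop :=
  ∀ (j : Fin d) (x : Fin d → ℝ), (∀ i, i ≠ j → x i ≠ 0) →
    LocallyACOffZero (fun t : ℝ => g (Function.update x j t))

/-- `f = D^0 f` and its derivatives `D^η f`, `η ≠ (1,…,1)`, are locally absolutely continuous on
`(ℝ \ {0})^d` in each variable. These derivatives then exist at every point of `(ℝ \ {0})^d`,
by continuity of `D^η f` in the variable of the last differentiation, and the derivative for
`η = (1,…,1)` exists almost everywhere on every line parallel to the axis of its last
differentiation inside `(ℝ \ {0})^d`, so the default value of `deriv` plays no role. -/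
def HasLocallyACDerivs {d : ℕ} (f : (Fin d → ℝ) → ℂ) : Prop :=
  ∀ η : Finset (Fin d), η ≠ Finset.univ → LocallyACInEachVariable (mixedDeriv η f)

end

/-! ### Absolutely continuous complex functions on the line -/

/-! The proof works with the mixed differences `Δ_h f` and shows that their `L_2` norms are small
enough for a Bernstein-type dyadic summation on the Fourier side.

The link with the derivatives is `integral_mixedDeriv_eq_integral_mixedDiff`, a Newton–Leibniz
formula over boxes that holds across the coordinate hyperplanes because `f` is continuous there. It
has two consequences. Shrinking the box in the variables outside `η` gives `‖Δ_h^η f‖_p ≤ ∏_{i ∈ η}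
h_i ‖D^η f‖_p` (`lintegral_mixedDiff_rpow_le`). Hölder on boxes with unit sides outside `η` gives
the uniform bound `|Δ_h f| ≤ C ∏ min(1, h_i)^α`, where `0 < α ≤ 1 - 1/p_η` for all `η ≠ 0`
(`norm_stepDiff_univ_le`).

Hölder with weights `w_η` on the `L_{p_η}` bounds and `γ` on the uniform bound then estimates `‖Δ_h
f‖_2` by `C ∏ h_i^κ min(1, h_i)^{αγ}`. Equal weights `2^{-d}` would give `κ = 1/2`, `γ = 0`, and `∑
w_η/p_η > 1/2`. The excess allows every weight to be lowered, the one of `η = 0` far more than the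
others, so that `κ < 1/2 < κ + αγ` (`exists_interpolation_weights`).

On the dyadic shell `|ξ_i| ~ 2^{s_i}` the multiplier of `Δ_h` with `h_i = 2^{-s_i}` has modulus at
least 1. Cauchy–Schwarz bounds the `L_1` norm there of the prospective transform `g` of `f` by `∏
h_i^{-1/2} ‖Δ_h f‖_2`, and the two inequalities on `κ` make the sum over the shells converge at both
ends (`integrable_div_stepMultiplier`). As `f` need not be in `L_2`, `g` is defined as the transform
of `Δ_1 f` divided by its multiplier. Finally `f` and the Fourier integral of `g` have the same
`Δ_1` and both vanish at infinity, hence coincide (`eq_integral_fourierChar_of_integrable`). -/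

theorem AbsolutelyContinuousOnInterval.of_dist_le {X Y : Type*} [PseudoMetricSpace X]
    [PseudoMetricSpace Y] {φ : ℝ → X} {ψ : ℝ → Y} {a b : ℝ}
    (hφ : AbsolutelyContinuousOnInterval φ a b) (h : ∀ s t, dist (ψ s) (ψ t) ≤ dist (φ s) (φ t)) :
    AbsolutelyContinuousOnInterval ψ a b :=
  squeeze_zero (fun _ => Finset.sum_nonneg fun _ _ => dist_nonneg)
    (fun _ => Finset.sum_le_sum fun _ _ => h _ _) hφ

theorem AbsolutelyContinuousOnInterval.integral_deriv_complex_eq_sub {φ : ℝ → ℂ} {a b : ℝ}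
    (hφ : AbsolutelyContinuousOnInterval φ a b) : ∫ t in a..b, deriv φ t = φ b - φ a := by
  have hre : AbsolutelyContinuousOnInterval (fun t => (φ t).re) a b := hφ.of_dist_le fun s t => by
    simpa [Real.dist_eq, Complex.dist_eq] using Complex.abs_re_le_norm (φ s - φ t)
  have him : AbsolutelyContinuousOnInterval (fun t => (φ t).im) a b := hφ.of_dist_le fun s t => by
    simpa [Real.dist_eq, Complex.dist_eq] using Complex.abs_im_le_norm (φ s - φ t)
  have key : ∫ t in a..b, deriv φ t = ∫ t in a..b,
      (((deriv (fun t => (φ t).re) t : ℝ) : ℂ) + ((deriv (fun t => (φ t).im) t : ℝ) : ℂ) * Complex.I) := by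
    apply intervalIntegral.integral_congr_ae
    filter_upwards [hre.ae_differentiableAt, him.ae_differentiableAt] with t h1 h2 ht
    have ht' := uIoc_subset_uIcc ht
    have e1 := (h1 ht').hasDerivAt.ofReal_comp
    have e2 := (h2 ht').hasDerivAt.ofReal_comp
    have e3 := e1.add (e2.mul_const Complex.I)
    have : HasDerivAt φ (((deriv (fun t => (φ t).re) t : ℝ) : ℂ) +
        ((deriv (fun t => (φ t).im) t : ℝ) : ℂ) * Complex.I) t := by
      convert! e3 using 1
      ext s
      simp
    exact this.deriv
  rw [key, intervalIntegral.integral_add, intervalIntegral.integral_mul_const,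
    intervalIntegral.integral_ofReal, intervalIntegral.integral_ofReal,
    hre.integral_deriv_eq_sub, him.integral_deriv_eq_sub]
  · apply Complex.ext <;> simp
  · exact ⟨hre.intervalIntegrable_deriv.1.ofReal, hre.intervalIntegrable_deriv.2.ofReal⟩
  · exact IntervalIntegrable.mul_const
      ⟨him.intervalIntegrable_deriv.1.ofReal, him.intervalIntegrable_deriv.2.ofReal⟩ _

/-- Lebesgue differentiation: at almost every `t`, `v t` and `U t` are derivatives of the same
primitive. -/
theorem ae_eq_of_forall_intervalIntegral_eq {U v : ℝ → ℂ} (hU : Continuous U)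
    (hv : ∀ s t, s < t → IntervalIntegrable v volume s t)
    (h : ∀ s t, s < t → ∫ τ in s..t, v τ = ∫ τ in s..t, U τ) : ∀ᵐ t, v t = U t := by
  have hn : ∀ n : ℕ, ∀ᵐ t : ℝ, t ∈ Ioo (-(n : ℝ)) n → v t = U t := by
    intro n
    rcases Nat.eq_zero_or_pos n with rfl | hpos
    · simp
    have hn : (0 : ℝ) < n := by exact_mod_cast hpos
    have hlt : (-(n : ℝ)) < n := by linarith
    filter_upwards [(hv _ _ hlt).ae_hasDerivAt_integral] with t ht hmem
    have h1 := ht (by rw [uIcc_of_le hlt.le]; exact Ioo_subset_Icc_self hmem) (-(n : ℝ)) (by simp)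
    have h2 : HasDerivAt (fun x => ∫ τ in (-(n : ℝ))..x, U τ) (U t) t :=
      intervalIntegral.integral_hasDerivAt_right (hU.intervalIntegrable _ _)
        hU.stronglyMeasurable.stronglyMeasurableAtFilter hU.continuousAt
    refine h1.unique (h2.congr_of_eventuallyEq ?_)
    filter_upwards [lt_mem_nhds hmem.1] with x hx
    exact h _ _ hx
  filter_upwards [ae_all_iff.2 hn] with t ht
  obtain ⟨n, hn⟩ := exists_nat_gt |t|
  exact ht n (abs_lt.1 hn)

/-- Continuous functions are not affected by the crossing of `0` in a Newton--Leibniz formula. -/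
theorem sub_eq_intervalIntegral_of_ae_off_zero {U v V : ℝ → ℂ} {P : ℝ → Prop} (hU : Continuous U)
    (hv : ∀ s t, s < t → IntervalIntegrable v volume s t)
    (hV : ∀ s t, s < t → IntervalIntegrable V volume s t)
    (h : ∀ s t, s < t → ∫ τ in s..t, v τ = ∫ τ in s..t, U τ)
    (hP : ∀ᵐ t, P t)
    (hvV : ∀ s t, P s → P t → s < t → (0 : ℝ) ∉ Icc s t → v t - v s = ∫ τ in s..t, V τ)
    (a b : ℝ) : U b - U a = ∫ τ in a..b, V τ := by
  have hV' : ∀ s t, IntervalIntegrable V volume s t := by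
    intro s t
    rcases lt_trichotomy s t with h | h | h
    · exact hV _ _ h
    · rw [h]
    · exact (hV _ _ h).symm
  set w : ℝ → ℂ := fun t => U t - ∫ τ in (0 : ℝ)..t, V τ with hw
  have hwc : Continuous w := hU.sub (intervalIntegral.continuous_primitive hV' 0)
  set Q : Set ℝ := {t | P t ∧ v t = U t} with hQ
  have hQae : ∀ᵐ t, t ∈ Q := by
    filter_upwards [hP, ae_eq_of_forall_intervalIntegral_eq hU hv h] with t h1 h2 using ⟨h1, h2⟩
  have hQd : Dense Q := Measure.dense_of_ae hQae
  have hlt : ∀ s ∈ Q, ∀ t ∈ Q, s < t → (0 : ℝ) ∉ Icc s t → w s = w t := by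
    intro s hs t ht hst h0
    have h1 := hvV s t hs.1 ht.1 hst h0
    rw [hs.2, ht.2] at h1
    have h2 := intervalIntegral.integral_add_adjacent_intervals (hV' 0 s) (hV' s t)
    simp only [hw]
    rw [← h2, ← h1]; ring
  have hcst : ∀ s ∈ Q, ∀ t ∈ Q, 0 < s * t → w s = w t := by
    intro s hs t ht hst
    have hz : ∀ s t : ℝ, 0 < s * t → (0 : ℝ) ∉ Icc s t := by
      rintro s t hst ⟨h1, h2⟩
      nlinarith
    rcases lt_trichotomy s t with h | h | h
    · exact hlt s hs t ht h (hz _ _ hst)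
    · rw [h]
    · exact (hlt t ht s hs h (hz _ _ (by linarith))).symm
  have hside : ∀ O : Set ℝ, IsOpen O → (∀ s ∈ O, ∀ t ∈ O, 0 < s * t) → O.Nonempty →
      (0 : ℝ) ∈ closure O → ∀ t ∈ O, w t = w 0 := by
    intro O hO hpos hne h0 t ht
    obtain ⟨s, hsO, hsQ⟩ := hQd.inter_open_nonempty O hO hne
    have hsub : closure O ⊆ {x | w x = w s} := by
      have h1 : closure (O ∩ Q) ⊆ {x | w x = w s} :=
        closure_minimal (fun x hx => hcst x hx.2 s hsQ (hpos x hx.1 s hsO))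
          (isClosed_eq hwc continuous_const)
      exact (closure_minimal (hQd.open_subset_closure_inter hO) isClosed_closure).trans h1
    rw [show w t = w s from hsub (subset_closure ht), show w 0 = w s from hsub h0]
  have hall : ∀ t, w t = w 0 := by
    intro t
    rcases lt_trichotomy t 0 with ht | ht | ht
    · refine hside (Iio 0) isOpen_Iio (fun s hs t ht => mul_pos_of_neg_of_neg hs ht) ⟨t, ht⟩
        (by simp) t ht
    · rw [ht]
    · refine hside (Ioi 0) isOpen_Ioi (fun s hs t ht => mul_pos hs ht) ⟨t, ht⟩
        (by simp) t ht
  have h1 := (hall b).trans (hall a).symm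
  have h2 := intervalIntegral.integral_add_adjacent_intervals (hV' 0 a) (hV' a b)
  simp only [hw] at h1
  linear_combination h1 - h2

/-! ### Product measures and one-coordinate updates -/

/-- Fubini in the coordinate `j` without splitting the index type. The old `j`-th coordinate is
overwritten, so `μ j` contributes only its total mass, which has to be 1; below it is a Dirac mass.
-/
theorem measurePreserving_update_pi {ι : Type*} [Fintype ι] [DecidableEq ι]
    {μ μ' : ι → Measure ℝ} [∀ i, SigmaFinite (μ i)] [∀ i, SigmaFinite (μ' i)] (j : ι)
    [IsProbabilityMeasure (μ j)] (h : ∀ i, i ≠ j → μ' i = μ i) :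
    MeasurePreserving (fun p : (ι → ℝ) × ℝ => Function.update p.1 j p.2)
      ((Measure.pi μ).prod (μ' j)) (Measure.pi μ') := by
  have hm : Measurable (fun p : (ι → ℝ) × ℝ => Function.update p.1 j p.2) :=
    measurable_pi_lambda _ fun i => by
      by_cases hi : i = j
      · subst hi; simpa using measurable_snd
      · simp only [Function.update_of_ne hi]; fun_prop
  refine ⟨hm, ?_⟩
  symm
  apply Measure.pi_eq
  intro s hs
  rw [Measure.map_apply hm (MeasurableSet.univ_pi hs)]
  have : (fun p : (ι → ℝ) × ℝ => Function.update p.1 j p.2) ⁻¹' (univ.pi s) =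
      (univ.pi (Function.update s j univ)) ×ˢ s j := by
    ext p
    simp only [mem_preimage, Set.mem_pi, mem_univ, true_implies, mem_prod]
    constructor
    · intro hp
      refine ⟨fun i => ?_, by simpa using hp j⟩
      by_cases hi : i = j
      · subst hi; simp
      · simpa [Function.update_of_ne hi] using hp i
    · rintro ⟨h1, h2⟩ i
      by_cases hi : i = j
      · subst hi; simpa using h2
      · simpa [Function.update_of_ne hi] using h1 i
  rw [this, Measure.prod_prod, Measure.pi_pi, ← Finset.mul_prod_erase _ _ (Finset.mem_univ j),
    ← Finset.mul_prod_erase Finset.univ (fun i => (μ' i) (s i)) (Finset.mem_univ j)]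
  rw [Function.update_self, measure_univ, one_mul, mul_comm]
  congr 1
  refine Finset.prod_congr rfl fun i hi => ?_
  have hi' := Finset.ne_of_mem_erase hi
  rw [Function.update_of_ne hi', h i hi']

/-- Lebesgue measure on the face `y_i = a_i` (`i ∈ S`) of the box `∏ (a_i, b_i]`. -/
noncomputable def faceMeasure {d : ℕ} (a b : Fin d → ℝ) (S : Finset (Fin d)) :
    Measure (Fin d → ℝ) :=
  Measure.pi fun i => if i ∈ S then Measure.dirac (a i) else volume.restrict (Ioc (a i) (b i))

instance faceMeasure_factor_isFinite {d : ℕ} (a b : Fin d → ℝ) (S : Finset (Fin d)) (i : Fin d) :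
    IsFiniteMeasure
      (if i ∈ S then Measure.dirac (a i) else volume.restrict (Ioc (a i) (b i)) : Measure ℝ) := by
  split_ifs <;> infer_instance

instance {d : ℕ} (a b : Fin d → ℝ) (S : Finset (Fin d)) : IsFiniteMeasure (faceMeasure a b S) := by
  unfold faceMeasure; infer_instance

theorem faceMeasure_empty {d : ℕ} (a b : Fin d → ℝ) :
    faceMeasure a b ∅ = volume.restrict (univ.pi fun i => Ioc (a i) (b i)) := by
  simp [faceMeasure, volume_pi, Measure.restrict_pi_pi]

theorem faceMeasure_congr {d : ℕ} {a b a' b' : Fin d → ℝ} {S : Finset (Fin d)}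
    (ha : ∀ i, a i = a' i) (hb : ∀ i, i ∉ S → b i = b' i) :
    faceMeasure a b S = faceMeasure a' b' S := by
  unfold faceMeasure
  congr 1
  ext1 i
  by_cases hi : i ∈ S
  · simp [hi, ha i]
  · simp [hi, ha i, hb i hi]

theorem faceMeasure_real_univ {d : ℕ} {a b : Fin d → ℝ} (hab : ∀ i, a i ≤ b i) (S : Finset (Fin d)) :
    (faceMeasure a b S).real univ = ∏ i ∈ Sᶜ, (b i - a i) := by
  rw [Measure.real, faceMeasure, Measure.pi_univ, ENNReal.toReal_prod, ← Finset.prod_compl_mul_prod S]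
  have h1 : ∏ i ∈ S, ((if i ∈ S then Measure.dirac (a i) else volume.restrict (Ioc (a i) (b i)) :
      Measure ℝ) univ).toReal = 1 := Finset.prod_eq_one fun i hi => by simp [hi]
  rw [h1, mul_one]
  refine Finset.prod_congr rfl fun i hi => ?_
  have : i ∉ S := by simpa using hi
  simp [this, hab i]

theorem faceMeasure_ae_eq {d : ℕ} (a b : Fin d → ℝ) (S : Finset (Fin d)) :
    ∀ᵐ y ∂faceMeasure a b S, ∀ i ∈ S, y i = a i := by
  rw [ae_all_iff]
  intro i
  by_cases hi : i ∈ S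
  · have := (Measure.tendsto_eval_ae_ae (μ := fun i => if i ∈ S then Measure.dirac (a i)
      else volume.restrict (Ioc (a i) (b i))) (i := i))
    have h2 : ∀ᵐ t ∂(if i ∈ S then Measure.dirac (a i) else volume.restrict (Ioc (a i) (b i))),
        t = a i := by
      rw [if_pos hi]
      exact (ae_dirac_iff (measurableSet_singleton (a i))).2 rfl
    filter_upwards [this.eventually h2] with y hy _ using hy
  · simp [hi]

theorem faceMeasure_ae_mem {d : ℕ} {a b : Fin d → ℝ} (hab : ∀ i, a i ≤ b i) (S : Finset (Fin d)) :
    ∀ᵐ y ∂faceMeasure a b S, ∀ i, y i ∈ Icc (a i) (b i) := by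
  rw [ae_all_iff]
  intro i
  have := (Measure.tendsto_eval_ae_ae (μ := fun i => if i ∈ S then Measure.dirac (a i)
      else volume.restrict (Ioc (a i) (b i))) (i := i))
  have h2 : ∀ᵐ t ∂(if i ∈ S then Measure.dirac (a i) else volume.restrict (Ioc (a i) (b i))),
        t ∈ Icc (a i) (b i) := by
    by_cases hi : i ∈ S
    · rw [if_pos hi]
      exact (ae_dirac_iff measurableSet_Icc).2 ⟨le_rfl, hab i⟩
    · rw [if_neg hi]
      filter_upwards [ae_restrict_mem measurableSet_Ioc] with t ht using Ioc_subset_Icc_self ht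
  exact this.eventually h2

theorem faceMeasure_ae_ne {d : ℕ} (a b : Fin d → ℝ) (S : Finset (Fin d)) (c : ℝ) :
    ∀ᵐ y ∂faceMeasure a b S, ∀ i, i ∉ S → y i ≠ c := by
  rw [ae_all_iff]
  intro i
  by_cases hi : i ∈ S
  · simp [hi]
  · have := (Measure.tendsto_eval_ae_ae (μ := fun i => if i ∈ S then Measure.dirac (a i)
      else volume.restrict (Ioc (a i) (b i))) (i := i))
    have h2 : ∀ᵐ t ∂(if i ∈ S then Measure.dirac (a i) else volume.restrict (Ioc (a i) (b i))),
        t ≠ c := by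
      rw [if_neg hi]
      exact ae_restrict_of_ae (Measure.ae_ne volume c)
    filter_upwards [this.eventually h2] with y hy _ using hy

theorem measurePreserving_update_faceMeasure {d : ℕ} (a b : Fin d → ℝ) {S : Finset (Fin d)}
    {j : Fin d} (hj : j ∉ S) (s t : ℝ) :
    MeasurePreserving (fun p : (Fin d → ℝ) × ℝ => Function.update p.1 j p.2)
      ((faceMeasure a b (insert j S)).prod (volume.restrict (Ioc s t)))
      (faceMeasure (Function.update a j s) (Function.update b j t) S) := by
  have hprob : IsProbabilityMeasure ((fun i => if i ∈ insert j S then Measure.dirac (a i)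
      else volume.restrict (Ioc (a i) (b i))) j) := by
    simp only [Finset.mem_insert_self, if_true]; infer_instance
  have := measurePreserving_update_pi (μ := fun i => if i ∈ insert j S then Measure.dirac (a i)
      else volume.restrict (Ioc (a i) (b i)))
    (μ' := fun i => if i ∈ S then Measure.dirac (Function.update a j s i)
      else volume.restrict (Ioc (Function.update a j s i) (Function.update b j t i))) j
    (fun i hi => by simp [hi])
  simpa [hj, faceMeasure] using this

theorem integrable_update_faceMeasure {d : ℕ} {a b : Fin d → ℝ} {S : Finset (Fin d)}
    {j : Fin d} (hj : j ∉ S) {s t : ℝ} {F : (Fin d → ℝ) → ℂ}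
    (hF : Integrable F (faceMeasure (Function.update a j s) (Function.update b j t) S)) :
    Integrable (fun p : (Fin d → ℝ) × ℝ => F (Function.update p.1 j p.2))
      ((faceMeasure a b (insert j S)).prod (volume.restrict (Ioc s t))) :=
  (measurePreserving_update_faceMeasure a b hj s t).integrable_comp_of_integrable hF

theorem integral_faceMeasure_update {d : ℕ} {a b : Fin d → ℝ} {S : Finset (Fin d)}
    {j : Fin d} (hj : j ∉ S) {s t : ℝ} (hst : s ≤ t) {F : (Fin d → ℝ) → ℂ}
    (hF : Integrable F (faceMeasure (Function.update a j s) (Function.update b j t) S)) :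
    ∫ y, F y ∂faceMeasure (Function.update a j s) (Function.update b j t) S =
      ∫ τ in s..t, ∫ y, F (Function.update y j τ) ∂faceMeasure a b (insert j S) := by
  have hmp := measurePreserving_update_faceMeasure a b hj s t
  rw [← hmp.map_eq, integral_map hmp.measurable.aemeasurable
    (by rw [hmp.map_eq]; exact hF.aestronglyMeasurable),
    integral_prod_symm _ (integrable_update_faceMeasure hj hF), intervalIntegral.integral_of_le hst]

/-! ### Mixed differences over the faces of a box -/

/-- The mixed difference `∑_{T ⊆ S} (-1)^{|S \ T|} f(b_T, a_{S \ T}, y_{Sᶜ})`. -/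
noncomputable def mixedDiff {d : ℕ} (a b : Fin d → ℝ) (S : Finset (Fin d)) (f : (Fin d → ℝ) → ℂ)
    (y : Fin d → ℝ) : ℂ :=
  ∑ T ∈ S.powerset, (-1) ^ (S \ T).card * f (T.piecewise b (S.piecewise a y))

theorem mixedDiff_empty {d : ℕ} (a b : Fin d → ℝ) (f : (Fin d → ℝ) → ℂ) :
    mixedDiff a b ∅ f = f := by
  ext y; simp [mixedDiff]

/-- The subsets `T` that contain `j` give the difference at `b j`, the others the one at `a j` with
one more sign. -/
theorem mixedDiff_insert {d : ℕ} (a b : Fin d → ℝ) {S : Finset (Fin d)} {j : Fin d} (hj : j ∉ S)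
    (f : (Fin d → ℝ) → ℂ) (y : Fin d → ℝ) :
    mixedDiff a b (insert j S) f y =
      mixedDiff a b S f (Function.update y j (b j)) - mixedDiff a b S f (Function.update y j (a j)) := by
  unfold mixedDiff
  rw [Finset.sum_powerset_insert hj, add_comm, sub_eq_add_neg, ← Finset.sum_neg_distrib]
  congr 1
  · refine Finset.sum_congr rfl fun T hT => ?_
    have hT' := Finset.mem_powerset.1 hT
    have h1 : insert j S \ insert j T = S \ T := by
      ext i; simp only [Finset.mem_sdiff, Finset.mem_insert]; grind
    have h2 : (insert j T).piecewise b ((insert j S).piecewise a y) =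
        T.piecewise b (S.piecewise a (Function.update y j (b j))) := by
      ext i
      simp only [Finset.piecewise, Finset.mem_insert, Function.update_apply]
      grind
    rw [h1, h2]
  · refine Finset.sum_congr rfl fun T hT => ?_
    have hT' := Finset.mem_powerset.1 hT
    have h1 : (insert j S \ T).card = (S \ T).card + 1 := by
      rw [Finset.insert_sdiff_of_notMem _ (fun h => hj (hT' h)), Finset.card_insert_of_notMem]
      simp [hj]
    have h2 : T.piecewise b ((insert j S).piecewise a y) =
        T.piecewise b (S.piecewise a (Function.update y j (a j))) := by
      ext i
      simp only [Finset.piecewise, Finset.mem_insert, Function.update_apply]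
      grind
    rw [h1, h2]; ring

theorem mixedDiff_congr {d : ℕ} {a b a' b' : Fin d → ℝ} {S : Finset (Fin d)}
    (ha : ∀ i ∈ S, a i = a' i) (hb : ∀ i ∈ S, b i = b' i) (f : (Fin d → ℝ) → ℂ)
    {y y' : Fin d → ℝ} (hy : ∀ i, i ∉ S → y i = y' i) :
    mixedDiff a b S f y = mixedDiff a' b' S f y' := by
  refine Finset.sum_congr rfl fun T hT => ?_
  have hT' := Finset.mem_powerset.1 hT
  congr 2
  ext i
  simp only [Finset.piecewise]
  split_ifs with h1 h2
  · exact hb i (hT' h1)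
  · exact ha i h2
  · exact hy i h2

theorem continuous_mixedDiff {d : ℕ} (a b : Fin d → ℝ) (S : Finset (Fin d)) {f : (Fin d → ℝ) → ℂ}
    (hf : Continuous f) : Continuous (mixedDiff a b S f) := by
  refine continuous_finsetSum _ fun T _ => continuous_const.mul (hf.comp ?_)
  refine continuous_pi fun i => ?_
  simp only [Finset.piecewise]
  split_ifs
  · exact continuous_const
  · exact continuous_const
  · exact continuous_apply i

theorem norm_mixedDiff_le {d : ℕ} (a b : Fin d → ℝ) (S : Finset (Fin d)) {f : (Fin d → ℝ) → ℂ}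
    {M : ℝ} (hM : ∀ x, ‖f x‖ ≤ M) (y : Fin d → ℝ) : ‖mixedDiff a b S f y‖ ≤ 2 ^ S.card * M := by
  refine (norm_sum_le _ _).trans ?_
  have : ∀ T ∈ S.powerset, ‖(-1 : ℂ) ^ (S \ T).card * f (T.piecewise b (S.piecewise a y))‖ ≤ M :=
    fun T _ => by simpa using hM _
  refine (Finset.sum_le_sum this).trans ?_
  simp

theorem mixedDeriv_insert {d : ℕ} {S : Finset (Fin d)} {j : Fin d} (hj : ∀ i ∈ S, j < i)
    (f : (Fin d → ℝ) → ℂ) : mixedDeriv (insert j S) f = partialDeriv j (mixedDeriv S f) := by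
  unfold mixedDeriv
  rw [Finset.sort_insert _ (fun i hi => (hj i hi).le) (fun h => (hj j h).false)]
  rfl

theorem LocallyIntegrable.integrable_faceMeasure_empty {d : ℕ} {g : (Fin d → ℝ) → ℂ}
    (hg : LocallyIntegrable g volume) (a b : Fin d → ℝ) : Integrable g (faceMeasure a b ∅) := by
  rw [faceMeasure_empty]
  have : IntegrableOn g (Icc a b) := hg.integrableOn_isCompact isCompact_Icc
  exact this.mono_set fun x hx => ⟨fun i => (hx i trivial).1.le, fun i => (hx i trivial).2⟩

theorem integrable_faceMeasure_of_continuous {d : ℕ} {g : (Fin d → ℝ) → ℂ} (hg : Continuous g)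
    {M : ℝ} (hM : ∀ x, ‖g x‖ ≤ M) (a b : Fin d → ℝ) (S : Finset (Fin d)) :
    Integrable g (faceMeasure a b S) :=
  Integrable.of_bound hg.aestronglyMeasurable M (ae_of_all _ hM)

theorem intervalIntegral_partialDeriv {d : ℕ} {g : (Fin d → ℝ) → ℂ}
    (hg : LocallyACInEachVariable g) (j : Fin d) {y : Fin d → ℝ} (hy : ∀ i, i ≠ j → y i ≠ 0)
    {s t : ℝ} (hst : s ≤ t) (h0 : (0 : ℝ) ∉ Icc s t) :
    g (Function.update y j t) - g (Function.update y j s) =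
      ∫ τ in s..t, partialDeriv j g (Function.update y j τ) := by
  have := (hg j y hy s t (by rwa [uIcc_of_le hst])).integral_deriv_complex_eq_sub
  rw [← this]
  refine intervalIntegral.integral_congr fun τ _ => ?_
  simp [partialDeriv]

/-- The integral of `D^S f` over a box is the mixed difference of `f` in the variables of `S`,
integrated over the remaining ones; the box may meet the coordinate hyperplanes. -/
theorem integral_mixedDeriv_eq_integral_mixedDiff {d : ℕ} {f : (Fin d → ℝ) → ℂ} (hf : Continuous f)
    {M : ℝ} (hM : ∀ x, ‖f x‖ ≤ M) (hAC : HasLocallyACDerivs f)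
    (hint : ∀ S, LocallyIntegrable (mixedDeriv S f) volume) (S : Finset (Fin d)) :
    ∀ a b : Fin d → ℝ, (∀ i, a i ≤ b i) →
      ∫ y, mixedDeriv S f y ∂faceMeasure a b ∅ = ∫ y, mixedDiff a b S f y ∂faceMeasure a b S := by
  -- Each new index is smaller than the previous ones, so its derivative is the outermost one, as in
  -- `mixedDeriv`.
  induction S using Finset.induction_on_min with
  | empty => intro a b _; simp [mixedDeriv_empty, mixedDiff_empty]
  | insert j S hjS ih =>
    intro a b hab
    have hj : j ∉ S := fun h => (hjS j h).false
    have hSu : S ≠ Finset.univ := fun h => hj (h ▸ Finset.mem_univ j)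
    set g := mixedDeriv S f with hg
    set G := mixedDeriv (insert j S) f with hG
    have hGg : G = partialDeriv j g := mixedDeriv_insert hjS f
    -- As functions of `t = y_j`: `U` integrates the differences of `f` and is continuous even at
    -- `0`, while `v` and `V` are slice integrals of `D^S f` and `∂_j D^S f`. The induction
    -- hypothesis concerns boxes, not slices, so it only gives equal integrals of `v` and `U` over
    -- intervals.
    set U : ℝ → ℂ := fun t => ∫ y, mixedDiff a b S f (Function.update y j t)
      ∂faceMeasure a b (insert j S) with hU
    set v : ℝ → ℂ := fun t => ∫ y, g (Function.update y j t) ∂faceMeasure a b {j} with hv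
    set V : ℝ → ℂ := fun t => ∫ y, G (Function.update y j t) ∂faceMeasure a b {j} with hV
    have hgi : ∀ s t, Integrable (fun p : (Fin d → ℝ) × ℝ => g (Function.update p.1 j p.2))
        ((faceMeasure a b {j}).prod (volume.restrict (Ioc s t))) := fun s t =>
      integrable_update_faceMeasure (S := ∅) (by simp)
        (LocallyIntegrable.integrable_faceMeasure_empty (hint S) _ _)
    have hGi : ∀ s t, Integrable (fun p : (Fin d → ℝ) × ℝ => G (Function.update p.1 j p.2))
        ((faceMeasure a b {j}).prod (volume.restrict (Ioc s t))) := fun s t =>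
      integrable_update_faceMeasure (S := ∅) (by simp)
        (LocallyIntegrable.integrable_faceMeasure_empty (hint _) _ _)
    have hUc : Continuous U := by
      refine continuous_of_dominated (bound := fun _ => 2 ^ S.card * M) ?_ ?_ ?_ ?_
      · intro t
        exact ((continuous_mixedDiff a b S hf).comp (by fun_prop)).aestronglyMeasurable
      · exact fun t => ae_of_all _ fun y => norm_mixedDiff_le a b S hM _
      · exact integrable_const _
      · exact ae_of_all _ fun y => (continuous_mixedDiff a b S hf).comp (by fun_prop)
    have hkey := sub_eq_intervalIntegral_of_ae_off_zero (U := U) (v := v) (V := V)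
      (P := fun t => Integrable (fun y => g (Function.update y j t)) (faceMeasure a b {j})) hUc
      (fun s t hst => (intervalIntegrable_iff_integrableOn_Ioc_of_le hst.le).2
        (hgi s t).integral_prod_right)
      (fun s t hst => (intervalIntegrable_iff_integrableOn_Ioc_of_le hst.le).2
        (hGi s t).integral_prod_right) ?_ ?_ ?_ (a j) (b j)
    · have h1 := integral_faceMeasure_update (a := a) (b := b) (S := ∅) (j := j) (by simp) (hab j)
        (F := G) (LocallyIntegrable.integrable_faceMeasure_empty (hint _) _ _)
      simp only [Function.update_eq_self, insert_empty_eq] at h1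
      rw [h1, ← hkey, hU, ← integral_sub]
      · refine integral_congr_ae (ae_of_all _ fun y => ?_)
        exact (mixedDiff_insert a b hj f y).symm
      · exact integrable_faceMeasure_of_continuous
          ((continuous_mixedDiff a b S hf).comp (by fun_prop))
          (fun y => norm_mixedDiff_le a b S hM _) _ _ _
      · exact integrable_faceMeasure_of_continuous
          ((continuous_mixedDiff a b S hf).comp (by fun_prop))
          (fun y => norm_mixedDiff_le a b S hM _) _ _ _
    · intro s t hst
      have h1 := integral_faceMeasure_update (a := a) (b := b) (S := ∅) (j := j) (by simp) hst.le
        (F := g) (LocallyIntegrable.integrable_faceMeasure_empty (hint S) _ _)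
      have h2 := integral_faceMeasure_update (a := a) (b := b) (S := S) (j := j) hj hst.le
        (F := mixedDiff a b S f) (integrable_faceMeasure_of_continuous
          (continuous_mixedDiff a b S hf) (fun y => norm_mixedDiff_le a b S hM _) _ _ _)
      rw [insert_empty_eq] at h1
      rw [hv, ← h1, hU, ← h2, ih]
      · refine integral_congr_ae (ae_of_all _ fun y => ?_)
        refine mixedDiff_congr (fun i hi => ?_) (fun i hi => ?_) f (fun _ _ => rfl)
        · rw [Function.update_of_ne (ne_of_mem_of_not_mem hi hj)]
        · rw [Function.update_of_ne (ne_of_mem_of_not_mem hi hj)]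
      · intro i
        by_cases hi : i = j
        · subst hi; simpa using hst.le
        · simpa [Function.update_of_ne hi] using hab i
    · have hn : ∀ n : ℕ, ∀ᵐ t : ℝ, t ∈ Ioc (-(n : ℝ)) n →
          Integrable (fun y => g (Function.update y j t)) (faceMeasure a b {j}) := fun n =>
        (ae_restrict_iff' measurableSet_Ioc).1 (hgi _ _).prod_left_ae
      filter_upwards [ae_all_iff.2 hn] with t ht
      obtain ⟨n, hn⟩ := exists_nat_gt |t|
      exact ht n (Ioo_subset_Ioc_self (abs_lt.1 hn))
    · intro s t hs ht hst h0
      rw [hv, ← integral_sub ht hs, hV, intervalIntegral.integral_of_le hst.le,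
        ← integral_integral_swap (f := fun y τ => G (Function.update y j τ)) (hGi s t)]
      refine integral_congr_ae ?_
      -- Absolute continuity in `x_j` is available only when the other variables are nonzero, which
      -- holds almost everywhere on the face.
      filter_upwards [faceMeasure_ae_ne a b {j} 0] with y hy
      rw [intervalIntegral_partialDeriv (hAC S hSu) j (fun i hi => hy i (by simpa using hi)) hst.le h0,
        intervalIntegral.integral_of_le hst.le, hGg]

/-! ### Norms of mixed differences -/

theorem lintegral_box_rpow_le {d : ℕ} {μ : Measure (Fin d → ℝ)} {u : (Fin d → ℝ) → ℝ≥0∞}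
    (hu : AEMeasurable u μ) {p : ℝ} (hp : 1 ≤ p) :
    ∫⁻ y, u y ∂μ ≤ (∫⁻ y, u y ^ p ∂μ) ^ (1 / p) * μ univ ^ (1 - 1 / p) := by
  have := eLpNorm'_le_eLpNorm'_mul_rpow_measure_univ (f := u) (μ := μ) one_pos hp
    hu.aestronglyMeasurable
  simpa [eLpNorm', enorm_eq_self] using this

/-- Tonelli and translation invariance. This makes averaging over moving boxes bounded in `L_p`. -/
theorem lintegral_translates {d : ℕ} {u : (Fin d → ℝ) → ℝ≥0∞} (hu : Measurable u)
    (μ : Measure (Fin d → ℝ)) [SFinite μ] :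
    ∫⁻ x, ∫⁻ z, u (x + z) ∂μ = μ univ * ∫⁻ x, u x := by
  rw [lintegral_lintegral_swap (f := fun x z => u (x + z)) (hu.comp measurable_add).aemeasurable]
  simp_rw [lintegral_add_right_eq_self u]
  simp [mul_comm]

theorem faceMeasure_empty_univ {d : ℕ} {a b : Fin d → ℝ} (hab : ∀ i, a i ≤ b i) :
    faceMeasure a b ∅ univ = ENNReal.ofReal (∏ i, (b i - a i)) := by
  rw [← ENNReal.ofReal_toReal (measure_ne_top (faceMeasure a b ∅) univ)]
  congr 1
  simpa [Measure.real] using faceMeasure_real_univ hab ∅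

theorem faceMeasure_empty_absolutelyContinuous {d : ℕ} (a b : Fin d → ℝ) :
    faceMeasure a b ∅ ≪ volume := by
  rw [faceMeasure_empty]; exact Measure.absolutelyContinuous_of_le Measure.restrict_le_self

theorem lintegral_faceMeasure_translate {d : ℕ} {u : (Fin d → ℝ) → ℝ≥0∞}
    (x r : Fin d → ℝ) :
    ∫⁻ y, u y ∂faceMeasure x (x + r) ∅ = ∫⁻ z, u (x + z) ∂faceMeasure 0 r ∅ := by
  rw [faceMeasure_empty, faceMeasure_empty]
  have hmp : MeasurePreserving (fun z : Fin d → ℝ => x + z) volume volume :=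
    measurePreserving_add_left volume x
  have := hmp.setLIntegral_comp_preimage_emb (measurableEmbedding_addLeft x) u
    (univ.pi fun i => Ioc (x i) ((x + r) i))
  rw [← this]
  congr 2
  ext z
  simp

theorem enorm_integral_faceMeasure_le {d : ℕ} {G : (Fin d → ℝ) → ℂ}
    (hG : AEStronglyMeasurable G volume) {p : ℝ} (hp : 1 ≤ p) {a b : Fin d → ℝ}
    (hab : ∀ i, a i ≤ b i) :
    ‖∫ y, G y ∂faceMeasure a b ∅‖ₑ ≤
      eLpNorm' G p volume * ENNReal.ofReal (∏ i, (b i - a i)) ^ (1 - 1 / p) := by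
  refine (enorm_integral_le_lintegral_enorm _).trans ?_
  refine (lintegral_box_rpow_le
    ((hG.mono_ac (faceMeasure_empty_absolutelyContinuous a b)).enorm) hp).trans ?_
  rw [faceMeasure_empty_univ hab, eLpNorm']
  gcongr
  rw [faceMeasure_empty]
  exact Measure.restrict_le_self

/-- The coordinates in `S` are pinned at `x` and the others range over intervals of length `c n`, so
the face shrinks to the point `x` and has mass `c n ^ Sᶜ.card`. -/
theorem tendsto_average_faceMeasure {d : ℕ} {ψ : (Fin d → ℝ) → ℂ} (hψ : Continuous ψ)
    (x h : Fin d → ℝ) (hh : ∀ i, 0 ≤ h i) (S : Finset (Fin d)) {c : ℕ → ℝ} (hc : ∀ n, 0 < c n)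
    (hc0 : Tendsto c atTop (𝓝 0)) :
    Tendsto (fun n => ((c n : ℂ) ^ Sᶜ.card)⁻¹ *
      ∫ y, ψ y ∂faceMeasure x (x + S.piecewise h (fun _ => c n)) S) atTop (𝓝 (ψ x)) := by
  rw [Metric.tendsto_atTop]
  intro ε hε
  obtain ⟨δ, hδ, hδ'⟩ := Metric.continuous_iff.1 hψ x (ε / 2) (half_pos hε)
  obtain ⟨n₀, hn₀⟩ := (Metric.tendsto_atTop.1 hc0) δ hδ
  refine ⟨n₀, fun n hn => ?_⟩
  have hcn : c n < δ := by simpa [abs_of_pos (hc n)] using hn₀ n hn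
  have hle : ∀ i, x i ≤ (x + S.piecewise h (fun _ => c n)) i := by
    intro i
    by_cases hi : i ∈ S
    · simpa [hi] using hh i
    · simpa [hi] using (hc n).le
  set μ := faceMeasure x (x + S.piecewise h (fun _ => c n)) S with hμ
  have hreal : μ.real univ = c n ^ Sᶜ.card := by
    rw [hμ, faceMeasure_real_univ hle, Finset.prod_congr rfl (g := fun _ => c n), Finset.prod_const]
    intro i hi
    have : i ∉ S := by simpa using hi
    simp [this]
  have hae : ∀ᵐ y ∂μ, ‖ψ y - ψ x‖ ≤ ε / 2 := by
    filter_upwards [faceMeasure_ae_eq x (x + S.piecewise h (fun _ => c n)) S,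
      faceMeasure_ae_mem hle S] with y hy1 hy2
    rw [← dist_eq_norm]
    refine (hδ' y ?_).le
    refine ((dist_pi_le_iff (hc n).le).2 fun i => ?_).trans_lt hcn
    by_cases hi : i ∈ S
    · simp [hy1 i hi, (hc n).le]
    · have := hy2 i
      simp only [Pi.add_apply, Finset.piecewise_eq_of_notMem _ _ _ hi, mem_Icc] at this
      rw [Real.dist_eq, abs_le]
      constructor <;> linarith [this.1, this.2, hc n]
  have hi : Integrable ψ μ := by
    refine Integrable.of_bound hψ.aestronglyMeasurable (‖ψ x‖ + ε / 2) ?_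
    filter_upwards [hae] with y hy
    have := norm_sub_norm_le (ψ y) (ψ x)
    linarith
  have hpos : 0 < c n ^ Sᶜ.card := pow_pos (hc n) _
  have heq : ((c n : ℂ) ^ Sᶜ.card)⁻¹ * ∫ y, ψ y ∂μ - ψ x =
      ((c n : ℂ) ^ Sᶜ.card)⁻¹ * ∫ y, (ψ y - ψ x) ∂μ := by
    rw [integral_sub hi (integrable_const _), integral_const, hreal]
    have : (c n : ℂ) ^ Sᶜ.card ≠ 0 := by exact_mod_cast hpos.ne'
    simp only [Complex.real_smul, Complex.ofReal_pow]
    field_simp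
  have hbd := norm_integral_le_of_norm_le_const hae
  rw [dist_eq_norm, heq, norm_mul, norm_inv, norm_pow, Complex.norm_real, Real.norm_of_nonneg (hc n).le]
  rw [hreal] at hbd
  calc (c n ^ Sᶜ.card)⁻¹ * ‖∫ y, (ψ y - ψ x) ∂μ‖ ≤ (c n ^ Sᶜ.card)⁻¹ * (ε / 2 * c n ^ Sᶜ.card) := by
        gcongr
    _ = ε / 2 := by field_simp
    _ < ε := by linarith

/-- If the integrals of `G` over boxes are those of the mixed differences of `f`, then
`‖Δ_h^S f‖_p ≤ ∏_{i ∈ S} h_i ‖G‖_p`. -/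
theorem lintegral_mixedDiff_rpow_le {d : ℕ} {f G : (Fin d → ℝ) → ℂ} {S : Finset (Fin d)}
    (hf : Continuous f) (hG : AEStronglyMeasurable G volume)
    (hbox : ∀ a b : Fin d → ℝ, (∀ i, a i ≤ b i) →
      ∫ y, G y ∂faceMeasure a b ∅ = ∫ y, mixedDiff a b S f y ∂faceMeasure a b S)
    {p : ℝ} (hp : 1 ≤ p) {h : Fin d → ℝ} (hh : ∀ i, 0 < h i) :
    ∫⁻ x, ‖mixedDiff x (x + h) S f x‖ₑ ^ p ≤
      ENNReal.ofReal (∏ i ∈ S, h i) ^ p * ∫⁻ x, ‖G x‖ₑ ^ p := by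
  have hp0 : 0 < p := by linarith
  -- A genuinely measurable representative makes `(x, z) ↦ G (x + z)` jointly measurable; the box
  -- integrals do not see the change.
  wlog hGm : StronglyMeasurable G generalizing G
  · have h1 := this (G := hG.mk G) hG.stronglyMeasurable_mk.aestronglyMeasurable
      (fun a b hab => by
        rw [← hbox a b hab]
        exact integral_congr_ae
          ((faceMeasure_empty_absolutelyContinuous a b).ae_eq hG.ae_eq_mk.symm))
      hG.stronglyMeasurable_mk
    refine h1.trans (le_of_eq ?_)
    congr 1
    refine lintegral_congr_ae ?_
    filter_upwards [hG.ae_eq_mk] with x hx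
    rw [hx]
  set c : ℕ → ℝ := fun n => 1 / ((n : ℝ) + 1) with hc
  have hc1 : ∀ n, 0 < c n := fun n => by positivity
  have hc0 : Tendsto c atTop (𝓝 0) := tendsto_one_div_add_atTop_nhds_zero_nat
  set r : ℕ → Fin d → ℝ := fun n => S.piecewise h (fun _ => c n) with hr
  have hr0 : ∀ n i, 0 < r n i := fun n i => by
    by_cases hi : i ∈ S
    · simpa [hr, hi] using hh i
    · simpa [hr, hi] using hc1 n
  have hrprod : ∀ n, ∏ i, r n i = (∏ i ∈ S, h i) * c n ^ Sᶜ.card := fun n => by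
    rw [← Finset.prod_mul_prod_compl S]
    congr 1
    · exact Finset.prod_congr rfl fun i hi => by simp [hr, hi]
    · rw [Finset.prod_congr rfl (g := fun _ => c n), Finset.prod_const]
      intro i hi
      have : i ∉ S := by simpa using hi
      simp [hr, this]
  have hu : Measurable fun x => ‖G x‖ₑ := hGm.enorm
  -- `K n x` dominates the `p`-th power of the average of the mixed difference over the thin face at
  -- `x`. Its integral is bounded uniformly in `n`, and Fatou passes to the limit.
  set K : ℕ → (Fin d → ℝ) → ℝ≥0∞ := fun n x =>
    ((ENNReal.ofReal (c n ^ Sᶜ.card))⁻¹ * ∫⁻ z, ‖G (x + z)‖ₑ ∂faceMeasure 0 (r n) ∅) ^ p with hK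
  have hKm : ∀ n, Measurable (K n) := fun n => by
    refine Measurable.pow_const (Measurable.const_mul ?_ _) p
    exact Measurable.lintegral_prod_right' (f := fun q : (Fin d → ℝ) × (Fin d → ℝ) => ‖G (q.1 + q.2)‖ₑ)
      (hu.comp measurable_add)
  have hint : ∀ n, ∫⁻ x, K n x ≤ ENNReal.ofReal (∏ i ∈ S, h i) ^ p * ∫⁻ x, ‖G x‖ₑ ^ p := by
    intro n
    set m := faceMeasure 0 (r n) ∅ univ with hm
    have hmeq : m = ENNReal.ofReal (∏ i ∈ S, h i) * ENNReal.ofReal (c n ^ Sᶜ.card) := by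
      rw [hm, faceMeasure_empty_univ (a := 0) (fun i => (hr0 n i).le), ← ENNReal.ofReal_mul
        (Finset.prod_nonneg fun i _ => (hh i).le), ← hrprod n]
      simp
    have hcpos : ENNReal.ofReal (c n ^ Sᶜ.card) ≠ 0 := by
      simpa using pow_pos (hc1 n) _
    have hm0 : m ≠ 0 := by
      rw [hmeq]
      refine mul_ne_zero ?_ hcpos
      simpa using Finset.prod_pos fun i _ => hh i
    have hmt : m ≠ ∞ := measure_ne_top _ _
    have hpt : ∀ x, K n x ≤ ENNReal.ofReal (c n ^ Sᶜ.card) ^ (-p) *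
        (m ^ (p - 1) * ∫⁻ z, ‖G (x + z)‖ₑ ^ p ∂faceMeasure 0 (r n) ∅) := by
      intro x
      simp only [hK]
      rw [ENNReal.mul_rpow_of_nonneg _ _ hp0.le, ENNReal.inv_rpow, ← ENNReal.rpow_neg]
      gcongr
      have h1 := lintegral_box_rpow_le (μ := faceMeasure 0 (r n) ∅) (u := fun z => ‖G (x + z)‖ₑ)
        (hu.comp (measurable_const_add x)).aemeasurable hp
      refine (ENNReal.rpow_le_rpow h1 hp0.le).trans (le_of_eq ?_)
      rw [ENNReal.mul_rpow_of_nonneg _ _ hp0.le, ← ENNReal.rpow_mul, ← ENNReal.rpow_mul, mul_comm]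
      have e1 : (1 - 1 / p) * p = p - 1 := by field_simp
      have e2 : 1 / p * p = 1 := by field_simp
      rw [e1, e2, ENNReal.rpow_one]
    refine (lintegral_mono hpt).trans (le_of_eq ?_)
    have hmeas : Measurable fun x => ∫⁻ z, ‖G (x + z)‖ₑ ^ p ∂faceMeasure 0 (r n) ∅ :=
      Measurable.lintegral_prod_right'
        (f := fun q : (Fin d → ℝ) × (Fin d → ℝ) => ‖G (q.1 + q.2)‖ₑ ^ p)
        ((hu.comp measurable_add).pow_const p)
    rw [lintegral_const_mul _ (hmeas.const_mul _), lintegral_const_mul _ hmeas,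
      lintegral_translates (u := fun x => ‖G x‖ₑ ^ p) (hu.pow_const p), ← mul_assoc, ← mul_assoc]
    congr 1
    rw [mul_assoc, ← hm]
    nth_rewrite 2 [← ENNReal.rpow_one m]
    -- The factor `m^{p-1}` from Hölder and `m` from the translates give `m^p`, whose thin sides
    -- cancel against the normalisation of the average.
    rw [← ENNReal.rpow_add _ _ hm0 hmt, sub_add_cancel, hmeq, ENNReal.mul_rpow_of_nonneg _ _ hp0.le,
      mul_left_comm, ← ENNReal.rpow_add _ _ hcpos ENNReal.ofReal_ne_top, neg_add_cancel,
      ENNReal.rpow_zero, mul_one]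
  have hpt : ∀ x, ‖mixedDiff x (x + h) S f x‖ₑ ^ p ≤ liminf (fun n => K n x) atTop := by
    intro x
    have hlim := tendsto_average_faceMeasure (continuous_mixedDiff x (x + h) S hf) x h
      (fun i => (hh i).le) S hc1 hc0
    have hlim2 := ((ENNReal.continuous_rpow_const (y := p)).tendsto _).comp hlim.enorm
    rw [← hlim2.liminf_eq]
    refine liminf_le_liminf (Eventually.of_forall fun n => ?_)
    simp only [Function.comp, hK]
    refine ENNReal.rpow_le_rpow ?_ hp0.le
    rw [enorm_mul]
    have e1 : ‖((c n : ℂ) ^ Sᶜ.card)⁻¹‖ₑ = (ENNReal.ofReal (c n ^ Sᶜ.card))⁻¹ := by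
      rw [enorm_inv (by exact_mod_cast (pow_pos (hc1 n) _).ne'), ← ofReal_norm, norm_pow,
        Complex.norm_real, Real.norm_of_nonneg (hc1 n).le]
    rw [e1]
    gcongr
    have e2 : ∫ y, mixedDiff x (x + h) S f y ∂faceMeasure x (x + S.piecewise h (fun _ => c n)) S =
        ∫ y, G y ∂faceMeasure x (x + r n) ∅ := by
      rw [hbox x (x + r n) (fun i => by simpa using (hr0 n i).le)]
      refine integral_congr_ae (ae_of_all _ fun y => ?_)
      exact mixedDiff_congr (fun _ _ => rfl) (fun i hi => by simp [hr, hi]) f (fun _ _ => rfl)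
    rw [e2, ← lintegral_faceMeasure_translate (u := fun y => ‖G y‖ₑ)]
    exact enorm_integral_le_lintegral_enorm _
  calc ∫⁻ x, ‖mixedDiff x (x + h) S f x‖ₑ ^ p ≤ ∫⁻ x, liminf (fun n => K n x) atTop :=
        lintegral_mono hpt
    _ ≤ liminf (fun n => ∫⁻ x, K n x) atTop := lintegral_liminf_le hKm
    _ ≤ _ := (liminf_le_liminf (Eventually.of_forall hint)).trans (by simp)

/-! ### Uniform bounds of mixed differences -/

/-- Induction that removes averaging. If `T = S`, the integral is that of `G S` over a box with unit
sides outside `S`, and Hölder applies. Otherwise, for `j ∈ T \ S`, the value at `y_j = a_j` is its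
mean over `[a_j, a_j + 1]` minus the mean increment. The mean is an integral over the face of
`T.erase j`, and the increment is a difference in one more variable; both fall under the induction
hypothesis, whence the factor 2 per step. The case `T = univ` is a pointwise bound. -/
theorem norm_integral_mixedDiff_le {d : ℕ} {f : (Fin d → ℝ) → ℂ} (hf : Continuous f)
    {M : ℝ} (hM : ∀ x, ‖f x‖ ≤ M) {G : Finset (Fin d) → (Fin d → ℝ) → ℂ}
    (hG : ∀ S, AEStronglyMeasurable (G S) volume)
    (hbox : ∀ (S : Finset (Fin d)) (a b : Fin d → ℝ), (∀ i, a i ≤ b i) →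
      ∫ y, G S y ∂faceMeasure a b ∅ = ∫ y, mixedDiff a b S f y ∂faceMeasure a b S)
    {p : Finset (Fin d) → ℝ} (hp : ∀ S, 1 ≤ p S) {K : ℝ} (hK0 : 0 ≤ K)
    (hK : ∀ S, eLpNorm' (G S) (p S) volume ≤ ENNReal.ofReal K)
    {α : ℝ} (hα0 : 0 ≤ α) (hα : ∀ S, S ≠ ∅ → α ≤ 1 - 1 / p S) (n : ℕ) :
    ∀ (T S : Finset (Fin d)), S ⊆ T → (T \ S).card = n → ∀ a b : Fin d → ℝ,
      (∀ i ∈ S, a i < b i ∧ b i ≤ a i + 1) →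
      ‖∫ y, mixedDiff a b S f y ∂faceMeasure a (a + 1) T‖ ≤ 2 ^ n * K * ∏ i ∈ S, (b i - a i) ^ α := by
  induction n with
  | zero =>
    intro T S hST hcard a b hab
    have hTS : T = S := by
      rw [Finset.card_eq_zero, Finset.sdiff_eq_empty_iff_subset] at hcard
      exact hcard.antisymm hST
    subst hTS
    set b' := T.piecewise b (a + 1) with hb'
    have hab' : ∀ i, a i ≤ b' i := by
      intro i
      by_cases hi : i ∈ T
      · simpa [hb', hi] using (hab i hi).1.le
      · simp [hb', hi]
    have e1 : ∫ y, mixedDiff a b T f y ∂faceMeasure a (a + 1) T = ∫ y, G T y ∂faceMeasure a b' ∅ := by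
      rw [hbox T a b' hab', faceMeasure_congr (a' := a) (b' := b') (fun _ => rfl)
        (fun i hi => by simp [hb', hi])]
      refine integral_congr_ae (ae_of_all _ fun y => ?_)
      exact mixedDiff_congr (fun _ _ => rfl) (fun i hi => by simp [hb', hi]) f (fun _ _ => rfl)
    have e2 : ∏ i, (b' i - a i) = ∏ i ∈ T, (b i - a i) := by
      rw [← Finset.prod_mul_prod_compl T, Finset.prod_eq_one (s := Tᶜ), mul_one]
      · exact Finset.prod_congr rfl fun i hi => by simp [hb', hi]
      · intro i hi
        have : i ∉ T := by simpa using hi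
        simp [hb', this]
    have h0 : ∀ i ∈ T, 0 < b i - a i := fun i hi => sub_pos.2 (hab i hi).1
    have hprod : 0 < ∏ i ∈ T, (b i - a i) := Finset.prod_pos h0
    have h1 := enorm_integral_faceMeasure_le (hG T) (hp T) hab'
    rw [e2, ENNReal.ofReal_rpow_of_pos hprod] at h1
    have h2 : ‖∫ y, G T y ∂faceMeasure a b' ∅‖ₑ ≤
        ENNReal.ofReal (K * (∏ i ∈ T, (b i - a i)) ^ (1 - 1 / p T)) := by
      rw [ENNReal.ofReal_mul hK0]
      exact h1.trans (by gcongr; exact hK T)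
    rw [← ofReal_norm, ENNReal.ofReal_le_ofReal_iff (by positivity)] at h2
    rw [e1, pow_zero, one_mul]
    refine h2.trans (mul_le_mul_of_nonneg_left ?_ hK0)
    rw [Real.finsetProd_rpow _ _ fun i hi => (h0 i hi).le]
    -- For `T = ∅` the product is empty, so `α ≤ 1 - 1 / p ∅` is not needed; this permits `p ∅ = 1`.
    rcases T.eq_empty_or_nonempty with rfl | hne
    · simp
    · exact Real.rpow_le_rpow_of_exponent_ge hprod
        (Finset.prod_le_one (fun i hi => (h0 i hi).le) fun i hi => by linarith [(hab i hi).2])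
        (hα T hne.ne_empty)
  | succ n ih =>
    intro T S hST hcard a b hab
    obtain ⟨j, hj⟩ : (T \ S).Nonempty := Finset.card_pos.1 (by omega)
    obtain ⟨hjT, hjS⟩ := Finset.mem_sdiff.1 hj
    set T' := T.erase j with hT'
    have hjT' : j ∉ T' := Finset.notMem_erase j T
    have hTT' : insert j T' = T := Finset.insert_erase hjT
    set m := mixedDiff a b S f with hm
    have hmc : Continuous m := continuous_mixedDiff a b S hf
    have hmb : ∀ y, ‖m y‖ ≤ 2 ^ S.card * M := norm_mixedDiff_le a b S hM
    set B := 2 ^ n * K * ∏ i ∈ S, (b i - a i) ^ α with hB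
    have hA : ‖∫ y, m y ∂faceMeasure a (a + 1) T'‖ ≤ B := by
      refine ih T' S (fun i hi => Finset.mem_erase.2 ⟨ne_of_mem_of_not_mem hi hjS, hST hi⟩) ?_ a b hab
      rw [hT', Finset.erase_sdiff_comm, Finset.card_erase_of_mem hj, hcard]; rfl
    have hsplit := integral_faceMeasure_update (a := a) (b := a + 1) (S := T') (j := j) hjT'
      (s := a j) (t := a j + 1) (by linarith) (F := m)
      (integrable_faceMeasure_of_continuous hmc hmb _ _ _)
    have hup : Function.update (a + 1) j (a j + 1) = a + 1 := by
      conv_rhs => rw [← Function.update_eq_self j (a + 1)]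
      rfl
    rw [Function.update_eq_self, hup, hTT'] at hsplit
    have hτ : ∀ τ, ∫ y, mixedDiff a (Function.update b j τ) (insert j S) f y ∂faceMeasure a (a + 1) T =
        ∫ y, m (Function.update y j τ) ∂faceMeasure a (a + 1) T - ∫ y, m y ∂faceMeasure a (a + 1) T := by
      intro τ
      rw [← integral_sub (integrable_faceMeasure_of_continuous
        (g := fun y => m (Function.update y j τ)) (hmc.comp (by fun_prop))
        (fun y => hmb _) _ _ _) (integrable_faceMeasure_of_continuous hmc hmb _ _ _)]
      refine integral_congr_ae ?_
      filter_upwards [faceMeasure_ae_eq a (a + 1) T] with y hy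
      -- On this face `y j = a j`, so the lower term of the difference is `m y` itself.
      rw [mixedDiff_insert _ _ hjS, ← hy j hjT, Function.update_eq_self, Function.update_self]
      have : ∀ y, mixedDiff a (Function.update b j τ) S f y = m y := fun y =>
        mixedDiff_congr (fun _ _ => rfl)
          (fun i hi => Function.update_of_ne (ne_of_mem_of_not_mem hi hjS) _ _) f (fun _ _ => rfl)
      rw [this, this]
    have hbound : ∀ τ ∈ uIoc (a j) (a j + 1),
        ‖∫ y, m (Function.update y j τ) ∂faceMeasure a (a + 1) T -
          ∫ y, m y ∂faceMeasure a (a + 1) T‖ ≤ B := by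
      intro τ hτ'
      rw [uIoc_of_le (by linarith)] at hτ'
      rw [← hτ]
      have hle := ih T (insert j S) (Finset.insert_subset hjT hST) (by
        rw [Finset.sdiff_insert, Finset.card_erase_of_mem hj, hcard]; rfl) a (Function.update b j τ) (by
          intro i hi
          rcases Finset.mem_insert.1 hi with rfl | hi
          · simpa using hτ'
          · rw [Function.update_of_ne (ne_of_mem_of_not_mem hi hjS)]
            exact hab i hi)
      refine hle.trans ?_
      rw [Finset.prod_insert hjS, Function.update_self, hB]
      have e1 : ∏ i ∈ S, (Function.update b j τ i - a i) ^ α = ∏ i ∈ S, (b i - a i) ^ α :=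
        Finset.prod_congr rfl fun i hi => by
          rw [Function.update_of_ne (ne_of_mem_of_not_mem hi hjS)]
      rw [e1]
      have h0 : 0 ≤ ∏ i ∈ S, (b i - a i) ^ α := Finset.prod_nonneg fun i hi =>
        Real.rpow_nonneg (sub_nonneg.2 (hab i hi).1.le) _
      have h1 : (τ - a j) ^ α ≤ 1 :=
        Real.rpow_le_one (by linarith [hτ'.1]) (by linarith [hτ'.2]) hα0
      calc 2 ^ n * K * ((τ - a j) ^ α * ∏ i ∈ S, (b i - a i) ^ α)
          ≤ 2 ^ n * K * (1 * ∏ i ∈ S, (b i - a i) ^ α) := by gcongr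
        _ = _ := by rw [one_mul]
    have hcont : Continuous fun τ => ∫ y, m (Function.update y j τ) ∂faceMeasure a (a + 1) T := by
      refine continuous_of_dominated (bound := fun _ => 2 ^ S.card * M) ?_ ?_ ?_ ?_
      · intro t
        exact (hmc.comp (by fun_prop)).aestronglyMeasurable
      · exact fun t => ae_of_all _ fun y => hmb _
      · exact integrable_const _
      · exact ae_of_all _ fun y => hmc.comp (by fun_prop)
    have hI := intervalIntegral.norm_integral_le_of_norm_le_const hbound
    rw [intervalIntegral.integral_sub (hcont.intervalIntegrable _ _) (by simp), ← hsplit,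
      intervalIntegral.integral_const] at hI
    simp only [add_sub_cancel_left, one_smul, abs_one, mul_one] at hI
    have := norm_sub_norm_le (∫ y, m y ∂faceMeasure a (a + 1) T) (∫ y, m y ∂faceMeasure a (a + 1) T')
    rw [norm_sub_rev] at this
    rw [pow_succ]
    calc _ ≤ B + B := by linarith
      _ = _ := by rw [hB]; ring

/-! ### Differences with a fixed step -/

/-- The mixed difference `Δ_h^S f` with steps `h_i` in the variables of `S`. -/
noncomputable def stepDiff {d : ℕ} (h : Fin d → ℝ) (S : Finset (Fin d)) (f : (Fin d → ℝ) → ℂ)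
    (x : Fin d → ℝ) : ℂ :=
  mixedDiff x (x + h) S f x

theorem stepDiff_empty {d : ℕ} (h : Fin d → ℝ) (f : (Fin d → ℝ) → ℂ) : stepDiff h ∅ f = f := by
  ext x; simp [stepDiff, mixedDiff_empty]

theorem stepDiff_insert {d : ℕ} (h : Fin d → ℝ) {S : Finset (Fin d)} {j : Fin d} (hj : j ∉ S)
    (f : (Fin d → ℝ) → ℂ) (x : Fin d → ℝ) :
    stepDiff h (insert j S) f x = stepDiff h S f (x + Pi.single j (h j)) - stepDiff h S f x := by
  unfold stepDiff
  rw [mixedDiff_insert _ _ hj, Function.update_eq_self]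
  congr 1
  have hS : ∀ i ∈ S, i ≠ j := fun i hi => ne_of_mem_of_not_mem hi hj
  refine mixedDiff_congr (fun i hi => ?_) (fun i hi => ?_) f (fun i hi => ?_)
  · simp [hS i hi]
  · simp [hS i hi]
  · by_cases hij : i = j
    · subst hij; simp
    · simp [hij]

theorem continuous_stepDiff {d : ℕ} (h : Fin d → ℝ) (S : Finset (Fin d)) {f : (Fin d → ℝ) → ℂ}
    (hf : Continuous f) : Continuous (stepDiff h S f) := by
  induction S using Finset.induction_on with
  | empty => rwa [stepDiff_empty]
  | insert j S hj ih =>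
    have : stepDiff h (insert j S) f = fun x => stepDiff h S f (x + Pi.single j (h j)) -
      stepDiff h S f x := funext fun x => stepDiff_insert h hj f x
    rw [this]
    exact (ih.comp (by fun_prop)).sub ih

theorem eLpNorm_stepDiff_insert_le {d : ℕ} (h : Fin d → ℝ) {S : Finset (Fin d)} {j : Fin d}
    (hj : j ∉ S) {f : (Fin d → ℝ) → ℂ} (hf : Continuous f) {p : ℝ≥0∞} (hp : 1 ≤ p) :
    eLpNorm (stepDiff h (insert j S) f) p volume ≤ 2 * eLpNorm (stepDiff h S f) p volume := by
  have hc := continuous_stepDiff h S hf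
  have h1 : stepDiff h (insert j S) f = (stepDiff h S f ∘ fun x => x + Pi.single j (h j)) -
      stepDiff h S f := funext fun x => stepDiff_insert h hj f x
  have h2 := eLpNorm_comp_measurePreserving (p := p) hc.aestronglyMeasurable
    (measurePreserving_add_right volume (Pi.single j (h j)))
  rw [h1]
  refine (eLpNorm_sub_le (hc.comp (by fun_prop)).aestronglyMeasurable hc.aestronglyMeasurable hp).trans ?_
  rw [h2, two_mul]

theorem eLpNorm_stepDiff_union_le {d : ℕ} (h : Fin d → ℝ) (S R : Finset (Fin d))
    {f : (Fin d → ℝ) → ℂ} (hf : Continuous f) {p : ℝ≥0∞} (hp : 1 ≤ p) :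
    eLpNorm (stepDiff h (R ∪ S) f) p volume ≤ 2 ^ R.card * eLpNorm (stepDiff h S f) p volume := by
  induction R using Finset.induction_on with
  | empty => simp
  | insert j R hj ih =>
    rw [Finset.insert_union, Finset.card_insert_of_notMem hj]
    by_cases hjS : j ∈ R ∪ S
    · rw [Finset.insert_eq_of_mem hjS]
      refine ih.trans ?_
      gcongr
      · norm_num
      · omega
    · refine (eLpNorm_stepDiff_insert_le h hjS hf hp).trans ?_
      rw [pow_succ', mul_assoc]
      gcongr

theorem norm_stepDiff_union_le {d : ℕ} (h : Fin d → ℝ) (S R : Finset (Fin d))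
    {f : (Fin d → ℝ) → ℂ} {B : ℝ} (hB : ∀ x, ‖stepDiff h S f x‖ ≤ B) (x : Fin d → ℝ) :
    ‖stepDiff h (R ∪ S) f x‖ ≤ 2 ^ R.card * B := by
  have hB0 : 0 ≤ B := (norm_nonneg _).trans (hB 0)
  induction R using Finset.induction_on generalizing x with
  | empty => simpa using hB x
  | insert j R hj ih =>
    rw [Finset.insert_union, Finset.card_insert_of_notMem hj]
    by_cases hjS : j ∈ R ∪ S
    · rw [Finset.insert_eq_of_mem hjS]
      refine (ih x).trans ?_
      gcongr
      · norm_num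
      · omega
    · rw [stepDiff_insert h hjS]
      refine (norm_sub_le _ _).trans ?_
      have h1 := ih (x + Pi.single j (h j))
      have h2 := ih x
      rw [pow_succ]
      linarith

/-- The Hölder bound `‖Δ_h f‖_∞ ≤ C ∏ min(1, h_i)^α`. -/
theorem norm_stepDiff_univ_le {d : ℕ} {f : (Fin d → ℝ) → ℂ} (hf : Continuous f)
    {M : ℝ} (hM : ∀ x, ‖f x‖ ≤ M) {G : Finset (Fin d) → (Fin d → ℝ) → ℂ}
    (hG : ∀ S, AEStronglyMeasurable (G S) volume)
    (hbox : ∀ (S : Finset (Fin d)) (a b : Fin d → ℝ), (∀ i, a i ≤ b i) →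
      ∫ y, G S y ∂faceMeasure a b ∅ = ∫ y, mixedDiff a b S f y ∂faceMeasure a b S)
    {p : Finset (Fin d) → ℝ} (hp : ∀ S, 1 ≤ p S) {K : ℝ} (hK0 : 0 ≤ K)
    (hK : ∀ S, eLpNorm' (G S) (p S) volume ≤ ENNReal.ofReal K)
    {α : ℝ} (hα0 : 0 ≤ α) (hα : ∀ S, S ≠ ∅ → α ≤ 1 - 1 / p S) {h : Fin d → ℝ} (hh : ∀ i, 0 < h i)
    (x : Fin d → ℝ) :
    ‖stepDiff h Finset.univ f x‖ ≤ 4 ^ d * K * ∏ i, min 1 (h i) ^ α := by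
  -- Only the short steps yield a gain; differencing in a variable with `h i > 1` costs a factor 2
  -- and corresponds to `min 1 (h i) = 1`.
  set S : Finset (Fin d) := Finset.univ.filter fun i => h i ≤ 1 with hS
  have hprod : ∏ i, min 1 (h i) ^ α = ∏ i ∈ S, h i ^ α := by
    rw [← Finset.prod_mul_prod_compl S, Finset.prod_eq_one (s := Sᶜ), mul_one]
    · refine Finset.prod_congr rfl fun i hi => ?_
      rw [min_eq_right (Finset.mem_filter.1 hi).2]
    · intro i hi
      have : ¬ h i ≤ 1 := by simpa [hS] using hi
      rw [min_eq_left (not_le.1 this).le, Real.one_rpow]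
  have hP0 : 0 ≤ ∏ i ∈ S, h i ^ α := Finset.prod_nonneg fun i _ => Real.rpow_nonneg (hh i).le _
  have hstep : ∀ y, ‖stepDiff h S f y‖ ≤ 2 ^ d * K * ∏ i ∈ S, h i ^ α := by
    intro y
    have h1 := norm_integral_mixedDiff_le hf hM hG hbox hp hK0 hK hα0 hα _ Finset.univ S
      (Finset.subset_univ S) rfl y (y + h) (fun i hi => ⟨by simpa using hh i, by
        simpa using (Finset.mem_filter.1 hi).2⟩)
    have h2 : ∫ z, mixedDiff y (y + h) S f z ∂faceMeasure y (y + 1) Finset.univ = stepDiff h S f y := by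
      have h3 : ∀ᵐ z ∂faceMeasure y (y + 1) Finset.univ,
          mixedDiff y (y + h) S f z = stepDiff h S f y := by
        filter_upwards [faceMeasure_ae_eq y (y + 1) Finset.univ] with z hz
        have : z = y := funext fun i => hz i (Finset.mem_univ i)
        rw [this]; rfl
      rw [integral_congr_ae h3, integral_const, faceMeasure_real_univ (fun i => by simp)]
      simp
    rw [h2] at h1
    refine h1.trans ?_
    have h4 : ∏ i ∈ S, ((y + h) i - y i) ^ α = ∏ i ∈ S, h i ^ α := by simp
    rw [h4]
    gcongr
    · norm_num
    · exact (Finset.card_le_univ _).trans (by simp)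
  have h5 := norm_stepDiff_union_le h S Finset.univ hstep x
  rw [Finset.union_eq_left.2 (Finset.subset_univ S)] at h5
  refine h5.trans (le_of_eq ?_)
  rw [hprod, Finset.card_univ, Fintype.card_fin, show (4 : ℝ) = 2 * 2 by norm_num, mul_pow]
  ring

/-- The derivative bound is used in the variables of `S`, the triangle inequality in the others. The
constant `4 ^ d * K` is larger than needed so as to agree with the one of the uniform bound. -/
theorem eLpNorm'_stepDiff_univ_le {d : ℕ} {f : (Fin d → ℝ) → ℂ} (hf : Continuous f)
    {G : (Fin d → ℝ) → ℂ} {S : Finset (Fin d)} (hG : AEStronglyMeasurable G volume)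
    (hbox : ∀ a b : Fin d → ℝ, (∀ i, a i ≤ b i) →
      ∫ y, G y ∂faceMeasure a b ∅ = ∫ y, mixedDiff a b S f y ∂faceMeasure a b S)
    {p : ℝ} (hp : 1 ≤ p) {K : ℝ} (hK : eLpNorm' G p volume ≤ ENNReal.ofReal K)
    {h : Fin d → ℝ} (hh : ∀ i, 0 < h i) :
    eLpNorm' (stepDiff h Finset.univ f) p volume ≤ ENNReal.ofReal (4 ^ d * K * ∏ i ∈ S, h i) := by
  have hp0 : 0 < p := by linarith
  have hP0 : 0 ≤ ∏ i ∈ S, h i := Finset.prod_nonneg fun i _ => (hh i).le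
  have h1 : eLpNorm' (stepDiff h S f) p volume ≤ ENNReal.ofReal (∏ i ∈ S, h i) * eLpNorm' G p volume := by
    have := ENNReal.rpow_le_rpow (lintegral_mixedDiff_rpow_le hf hG hbox hp hh)
      (one_div_nonneg.2 hp0.le)
    rw [ENNReal.mul_rpow_of_nonneg _ _ (one_div_nonneg.2 hp0.le), ← ENNReal.rpow_mul,
      mul_one_div_cancel hp0.ne', ENNReal.rpow_one] at this
    exact this
  have h2 := eLpNorm_stepDiff_union_le h S Finset.univ hf (p := ENNReal.ofReal p) (by simpa using hp)
  have e0 : ENNReal.ofReal p ≠ 0 := by simpa using hp0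
  rw [Finset.union_eq_left.2 (Finset.subset_univ S), eLpNorm_eq_eLpNorm' e0 ENNReal.ofReal_ne_top,
    eLpNorm_eq_eLpNorm' e0 ENNReal.ofReal_ne_top, ENNReal.toReal_ofReal hp0.le] at h2
  refine h2.trans ?_
  calc (2 : ℝ≥0∞) ^ (Finset.univ : Finset (Fin d)).card * eLpNorm' (stepDiff h S f) p volume
      ≤ ENNReal.ofReal (4 ^ d) * (ENNReal.ofReal (∏ i ∈ S, h i) * ENNReal.ofReal K) := by
        gcongr
        · rw [ENNReal.ofReal_pow (by norm_num)]
          simp only [Finset.card_univ, Fintype.card_fin]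
          gcongr
          norm_num
        · exact h1.trans (by gcongr)
    _ = _ := by
        rw [← ENNReal.ofReal_mul hP0, ← ENNReal.ofReal_mul (by positivity)]
        congr 1; ring

/-! ### Interpolation -/

theorem ENNReal.rpow_sum_of_nonneg' {ι : Type*} (s : Finset ι) (x : ℝ≥0∞) {w : ι → ℝ}
    (hw : ∀ i ∈ s, 0 ≤ w i) : x ^ (∑ i ∈ s, w i) = ∏ i ∈ s, x ^ w i := by
  classical
  induction s using Finset.induction_on with
  | empty => simp
  | insert i s hi ih =>
    rw [Finset.sum_insert hi, Finset.prod_insert hi, ENNReal.rpow_add_of_nonneg,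
      ih fun k hk => hw k (Finset.mem_insert_of_mem hk)]
    · exact hw i (Finset.mem_insert_self _ _)
    · exact Finset.sum_nonneg fun k hk => hw k (Finset.mem_insert_of_mem hk)

/-- Write `|u|^2 = |u|^{2γ} ∏ |u|^{2 w_i}`, bound the first factor by `B`, and apply Hölder to the
functions `|u|^{p_i}` with powers `2 w_i / p_i`, which sum to 1. -/
theorem eLpNorm'_two_le_prod {d : ℕ} {ι : Type*} (s : Finset ι) {u : (Fin d → ℝ) → ℂ}
    (hu : AEStronglyMeasurable u volume) {p w : ι → ℝ} {γ : ℝ} (hp : ∀ i ∈ s, 0 < p i)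
    (hw : ∀ i ∈ s, 0 ≤ w i) (hγ : 0 ≤ γ) (hsum : ∑ i ∈ s, w i + γ = 1)
    (hhalf : ∑ i ∈ s, w i / p i = 1 / 2) {B : ℝ≥0∞} (hB : ∀ x, ‖u x‖ₑ ≤ B) (hB' : B ≠ ∞)
    {N : ι → ℝ≥0∞} (hN : ∀ i ∈ s, eLpNorm' u (p i) volume ≤ N i) :
    eLpNorm' u 2 volume ≤ B ^ γ * ∏ i ∈ s, N i ^ w i := by
  have hpt : ∀ x, ‖u x‖ₑ ^ (2 : ℝ) ≤ B ^ (2 * γ) * ∏ i ∈ s, (‖u x‖ₑ ^ p i) ^ (2 * (w i / p i)) := by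
    intro x
    have e1 : ∏ i ∈ s, (‖u x‖ₑ ^ p i) ^ (2 * (w i / p i)) = ‖u x‖ₑ ^ ∑ i ∈ s, 2 * w i := by
      rw [ENNReal.rpow_sum_of_nonneg' s _ fun i hi => by have := hw i hi; positivity]
      refine Finset.prod_congr rfl fun i hi => ?_
      rw [← ENNReal.rpow_mul]
      congr 1
      have := (hp i hi).ne'
      field_simp
    have e2 : (2 : ℝ) = 2 * γ + ∑ i ∈ s, 2 * w i := by rw [← Finset.mul_sum]; linarith
    rw [e1]
    nth_rewrite 1 [e2]
    rw [ENNReal.rpow_add_of_nonneg _ _ (by positivity)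
      (Finset.sum_nonneg fun i hi => by have := hw i hi; positivity)]
    gcongr
    exact hB x
  have h1 : ∫⁻ x, ‖u x‖ₑ ^ (2 : ℝ) ≤ B ^ (2 * γ) *
      ∏ i ∈ s, (∫⁻ x, ‖u x‖ₑ ^ p i) ^ (2 * (w i / p i)) := by
    refine (lintegral_mono hpt).trans ?_
    rw [lintegral_const_mul' _ _ (ENNReal.rpow_ne_top_of_nonneg (by positivity) hB')]
    gcongr
    refine ENNReal.lintegral_prod_norm_pow_le s (fun i _ => hu.enorm.pow_const _) ?_ fun i hi => ?_
    · rw [← Finset.mul_sum, hhalf]; norm_num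
    · have := hw i hi; have := hp i hi; positivity
  have h2 := ENNReal.rpow_le_rpow h1 (show (0 : ℝ) ≤ 1 / 2 by norm_num)
  refine h2.trans ?_
  rw [ENNReal.mul_rpow_of_nonneg _ _ (by norm_num), ← ENNReal.rpow_mul,
    ← ENNReal.prod_rpow_of_nonneg (by norm_num)]
  have e3 : 2 * γ * (1 / 2) = γ := by ring
  rw [e3]
  gcongr with i hi
  rw [← ENNReal.rpow_mul]
  have e4 : 2 * (w i / p i) * (1 / 2) = 1 / p i * w i := by ring
  rw [e4, ENNReal.rpow_mul]
  exact ENNReal.rpow_le_rpow (hN i hi) (hw i hi)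

theorem card_filter_mem_finset {d : ℕ} (j : Fin d) :
    (2 : ℝ) * ((Finset.univ.filter fun η : Finset (Fin d) => j ∈ η).card : ℝ) = 2 ^ d := by
  have h1 : Finset.univ.filter (fun η : Finset (Fin d) => ¬ j ∈ η) =
      (Finset.univ.erase j).powerset := by
    ext η
    simp [Finset.subset_erase]
  have h2 := Finset.card_filter_add_card_filter_not (s := Finset.univ) (fun η : Finset (Fin d) => j ∈ η)
  rw [h1, Finset.card_powerset, Finset.card_erase_of_mem (Finset.mem_univ j)] at h2
  simp only [Finset.card_univ, Fintype.card_fin, Fintype.card_finset] at h2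
  have hd : d = d - 1 + 1 := by have := j.pos; omega
  have h3 : (2 : ℕ) ^ d = 2 * 2 ^ (d - 1) := by rw [hd, pow_succ]; simp [mul_comm]
  have h4 : 2 * (Finset.univ.filter fun η : Finset (Fin d) => j ∈ η).card = 2 ^ d := by omega
  exact_mod_cast h4

/-- Perturb the uniform weights `1/N`, `N = 2^d`: subtract `δ` at `∅` and `ε` elsewhere. Each `j`
lies in half of the sets, so `κ = 1/2 - Nε/2`, whereas `γ = (N-1)ε + δ`. The equation for `1/2`
requires `εA + δr = σ`, the excess of the uniform weights. With `ε` small compared with `δ`, the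
gain `αγ` outweighs the loss `Nε/2`. -/
theorem exists_interpolation_weights {d : ℕ} {P : Finset (Fin d) → ℝ}
    (hP : ∀ η, 0 ≤ P η) (hP0 : 0 < P ∅) {α : ℝ} (hα : 0 < α)
    (hle : 2 * ∑ η ∈ Finset.univ.erase ∅, P η ≤ 2 ^ d)
    (hlt : 2 ^ d < 2 * (∑ η ∈ Finset.univ.erase ∅, P η + P ∅)) :
    ∃ (w : Finset (Fin d) → ℝ) (γ κ : ℝ), (∀ η, 0 ≤ w η) ∧ 0 ≤ γ ∧ ∑ η, w η + γ = 1 ∧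
      ∑ η, w η * P η = 1 / 2 ∧ (∀ j, ∑ η ∈ Finset.univ.filter (fun η => j ∈ η), w η = κ) ∧
      κ < 1 / 2 ∧ 1 / 2 < κ + α * γ := by
  set A := ∑ η ∈ Finset.univ.erase ∅, P η with hA
  set r := P ∅ with hr
  set N : ℝ := 2 ^ d with hN
  have hN1 : 1 ≤ N := one_le_pow₀ (by norm_num)
  have hA0 : 0 ≤ A := Finset.sum_nonneg fun η _ => hP η
  set σ := (A + r) / N - 1 / 2 with hσ
  have hσ0 : 0 < σ := by
    rw [hσ, sub_pos, div_lt_div_iff₀ (by norm_num) (by linarith)]; linarith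
  -- The three bounds give, in order, nonnegative weights off `∅`, `δ ≥ σ/(2r)`, and `Nε/2 < αδ`.
  set ε := min (1 / N) (min (σ / (2 * (A + 1))) (α * σ / (2 * r * N))) with hε
  have hε0 : 0 < ε := by
    refine lt_min (by positivity) (lt_min (by positivity) (by positivity))
  have hε1 : ε ≤ 1 / N := min_le_left _ _
  have hε2 : ε * A ≤ σ / 2 := by
    have h1 : ε ≤ σ / (2 * (A + 1)) := (min_le_right _ _).trans (min_le_left _ _)
    rw [le_div_iff₀ (by positivity)] at h1
    nlinarith
  have hε3 : ε * (2 * r * N) ≤ α * σ := by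
    have h1 : ε ≤ α * σ / (2 * r * N) := (min_le_right _ _).trans (min_le_right _ _)
    rwa [le_div_iff₀ (by positivity)] at h1
  set δ := (σ - ε * A) / r with hδ
  have hδr : δ * r = σ - ε * A := by rw [hδ]; field_simp
  have hδ0 : σ / (2 * r) ≤ δ := by
    rw [hδ, div_le_div_iff₀ (by positivity) hP0]; nlinarith
  have hδpos : 0 < δ := lt_of_lt_of_le (by positivity) hδ0
  have hσN : σ * N = A + r - N / 2 := by rw [hσ]; field_simp
  -- Nonnegativity of the weight at `∅` is where `hle` enters: `σN = A + r - N/2 ≤ r`.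
  have hδ1 : δ ≤ 1 / N := by
    rw [le_div_iff₀ (by linarith)]
    have h1 : δ * N * r ≤ 1 * r := by
      have : δ * N * r = σ * N - ε * A * N := by rw [mul_right_comm, hδr]; ring
      rw [this, hσN]
      have : 0 ≤ ε * A * N := by positivity
      linarith
    exact le_of_mul_le_mul_right h1 hP0
  set w : Finset (Fin d) → ℝ := fun η => if η = ∅ then 1 / N - δ else 1 / N - ε with hw
  have hw1 : ∀ η ∈ Finset.univ.erase (∅ : Finset (Fin d)), w η = 1 / N - ε := fun η hη => by
    simp [hw, Finset.ne_of_mem_erase hη]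
  have hcard : ((Finset.univ.erase (∅ : Finset (Fin d))).card : ℝ) = N - 1 := by
    rw [Finset.card_erase_of_mem (Finset.mem_univ _), Nat.cast_sub (Finset.card_pos.2 ⟨∅, Finset.mem_univ _⟩)]
    simp [hN]
  have hsum : ∑ η, w η = (N - 1) * (1 / N - ε) + (1 / N - δ) := by
    rw [← Finset.sum_erase_add _ _ (Finset.mem_univ ∅), Finset.sum_congr rfl hw1, Finset.sum_const,
      nsmul_eq_mul, hcard]
    simp [hw]
  refine ⟨w, (N - 1) * ε + δ, N / 2 * (1 / N - ε), ?_, ?_, ?_, ?_, ?_, ?_, ?_⟩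
  · intro η
    simp only [hw]
    split_ifs <;> linarith
  · have : 0 ≤ (N - 1) * ε := mul_nonneg (by linarith) hε0.le
    linarith
  · rw [hsum]; field_simp; ring
  · rw [← Finset.sum_erase_add _ _ (Finset.mem_univ ∅),
      Finset.sum_congr rfl (fun η hη => by rw [hw1 η hη]), ← Finset.mul_sum, ← hA]
    simp only [hw, if_true]
    have : (1 / N - δ) * P ∅ = r / N - δ * r := by rw [← hr]; ring
    rw [this, hδr, hσ]; ring
  · intro j
    rw [Finset.sum_congr rfl (g := fun _ => 1 / N - ε)]
    · rw [Finset.sum_const, nsmul_eq_mul]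
      have := card_filter_mem_finset j
      rw [← hN] at this
      rw [show ((Finset.univ.filter fun η : Finset (Fin d) => j ∈ η).card : ℝ) = N / 2 by linarith]
    · intro η hη
      have : η ≠ ∅ := by rintro rfl; simp at hη
      simp [hw, this]
  · have : N / 2 * (1 / N - ε) = 1 / 2 - N * ε / 2 := by field_simp
    rw [this]
    have : 0 < N * ε := by positivity
    linarith
  · have h1 : N / 2 * (1 / N - ε) = 1 / 2 - N * ε / 2 := by field_simp
    have h2 : 0 ≤ (N - 1) * ε := mul_nonneg (by linarith) hε0.le
    have h3 : N * ε / 2 < α * δ := by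
      have h4 : N * ε / 2 ≤ α * (σ / (2 * r)) / 2 := by
        rw [mul_div_assoc', div_div, div_le_div_iff₀ (by norm_num) (by positivity)]
        nlinarith
      have h5 : α * (σ / (2 * r)) ≤ α * δ := by gcongr
      have h6 : 0 < α * (σ / (2 * r)) := by positivity
      linarith
    rw [h1]
    nlinarith

/-- The `L_2` norms of `Δ_h f` are `O(∏ h_i^κ min(1, h_i)^β)` with `κ < 1/2 < κ + β`. -/
theorem exists_eLpNorm'_two_stepDiff_le {d : ℕ} {f : (Fin d → ℝ) → ℂ} (hf : Continuous f)
    {M : ℝ} (hM : ∀ x, ‖f x‖ ≤ M) {G : Finset (Fin d) → (Fin d → ℝ) → ℂ}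
    (hG : ∀ S, AEStronglyMeasurable (G S) volume)
    (hbox : ∀ (S : Finset (Fin d)) (a b : Fin d → ℝ), (∀ i, a i ≤ b i) →
      ∫ y, G S y ∂faceMeasure a b ∅ = ∫ y, mixedDiff a b S f y ∂faceMeasure a b S)
    {p : Finset (Fin d) → ℝ} (hp : ∀ S, 1 ≤ p S) (hp1 : ∀ S, S ≠ ∅ → 1 < p S)
    (hK : ∀ S, eLpNorm' (G S) (p S) volume < ∞)
    (hle : 2 * ∑ η ∈ Finset.univ.erase ∅, (p η)⁻¹ ≤ 2 ^ d)
    (hlt : 2 ^ d < 2 * (∑ η ∈ Finset.univ.erase ∅, (p η)⁻¹ + (p ∅)⁻¹)) :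
    ∃ C κ β : ℝ, 0 ≤ C ∧ κ < 1 / 2 ∧ 1 / 2 < κ + β ∧ ∀ h : Fin d → ℝ, (∀ i, 0 < h i) →
      eLpNorm' (stepDiff h Finset.univ f) 2 volume ≤
        ENNReal.ofReal (C * ∏ i, (h i ^ κ * min 1 (h i) ^ β)) := by
  obtain ⟨K, hK0, hKS⟩ : ∃ K : ℝ, 0 ≤ K ∧ ∀ S, eLpNorm' (G S) (p S) volume ≤ ENNReal.ofReal K := by
    refine ⟨∑ S, (eLpNorm' (G S) (p S) volume).toReal,
      Finset.sum_nonneg fun _ _ => ENNReal.toReal_nonneg, fun S => ?_⟩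
    rw [← ENNReal.ofReal_toReal (hK S).ne]
    exact ENNReal.ofReal_le_ofReal
      (Finset.single_le_sum (f := fun S => (eLpNorm' (G S) (p S) volume).toReal)
        (fun _ _ => ENNReal.toReal_nonneg) (Finset.mem_univ S))
  obtain ⟨α, hα0, hα⟩ : ∃ α : ℝ, 0 < α ∧ ∀ S, S ≠ ∅ → α ≤ 1 - 1 / p S := by
    -- The value 1 at `∅` is a harmless filler: `1 - 1 / p ∅` may vanish.
    refine ⟨Finset.univ.inf' Finset.univ_nonempty fun S => if S = ∅ then 1 else 1 - 1 / p S, ?_, ?_⟩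
    · rw [Finset.lt_inf'_iff]
      intro S _
      split_ifs with hS
      · norm_num
      · rw [sub_pos, div_lt_one (by linarith [hp S])]
        exact hp1 S hS
    · intro S hS
      refine (Finset.inf'_le _ (Finset.mem_univ S)).trans ?_
      rw [if_neg hS]
  have hp0 : ∀ S, 0 < p S := fun S => by linarith [hp S]
  obtain ⟨w, γ, κ, hw, hγ, hsum, hhalf, hκ, hκ1, hκ2⟩ := exists_interpolation_weights
    (P := fun S => (p S)⁻¹) (fun S => (inv_pos.2 (hp0 S)).le) (inv_pos.2 (hp0 ∅)) hα0 hle hlt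
  refine ⟨4 ^ d * K, κ, α * γ, by positivity, hκ1, hκ2, fun h hh => ?_⟩
  set C : ℝ := 4 ^ d * K with hC
  have hC0 : 0 ≤ C := by positivity
  have hmin : ∀ i, 0 < min 1 (h i) := fun i => lt_min one_pos (hh i)
  have hB := norm_stepDiff_univ_le hf hM hG hbox hp hK0 hKS hα0.le hα hh
  have hN := fun S => eLpNorm'_stepDiff_univ_le hf (hG S) (hbox S) (hp S) (hKS S) hh
  have hBp : 0 ≤ ∏ i, min 1 (h i) ^ α := Finset.prod_nonneg fun i _ => Real.rpow_nonneg (hmin i).le _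
  have h1 := eLpNorm'_two_le_prod Finset.univ (continuous_stepDiff h Finset.univ hf).aestronglyMeasurable
    (fun S _ => hp0 S) (fun S _ => hw S) hγ hsum (by simpa [div_eq_mul_inv] using hhalf)
    (B := ENNReal.ofReal (C * ∏ i, min 1 (h i) ^ α))
    (fun x => by rw [← ofReal_norm]; exact ENNReal.ofReal_le_ofReal (hB x)) ENNReal.ofReal_ne_top
    (N := fun S => ENNReal.ofReal (C * ∏ i ∈ S, h i)) (fun S _ => hN S)
  refine h1.trans (le_of_eq ?_)
  have hSp : ∀ S : Finset (Fin d), 0 < ∏ i ∈ S, h i := fun S => Finset.prod_pos fun i _ => hh i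
  rw [ENNReal.ofReal_rpow_of_nonneg (by positivity) hγ]
  simp_rw [fun S => ENNReal.ofReal_rpow_of_nonneg (mul_nonneg hC0 (hSp S).le) (hw S)]
  rw [← ENNReal.ofReal_prod_of_nonneg (fun S _ => Real.rpow_nonneg (mul_nonneg hC0 (hSp S).le) _),
    ← ENNReal.ofReal_mul (Real.rpow_nonneg (mul_nonneg hC0 hBp) _)]
  congr 1
  rw [Real.mul_rpow hC0 hBp, Finset.prod_congr rfl fun S _ => Real.mul_rpow hC0 (hSp S).le,
    Finset.prod_mul_distrib, Finset.prod_mul_distrib]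
  -- The exponents sum to 1. For `C = 0` one of them must be nonzero, since `0 ^ 0 = 1`.
  have e1 : C ^ γ * ∏ S, C ^ w S = C := by
    rcases hC0.eq_or_lt with h0 | h0
    · rw [← h0]
      by_cases hγ0 : γ = 0
      · obtain ⟨S, hS⟩ : ∃ S, w S ≠ 0 := by
          by_contra! hcon
          rw [hγ0, Finset.sum_eq_zero fun S _ => hcon S] at hsum
          norm_num at hsum
        rw [Finset.prod_eq_zero (Finset.mem_univ S) (Real.zero_rpow hS), mul_zero]
      · rw [Real.zero_rpow hγ0, zero_mul]
    · rw [← Real.rpow_sum_of_pos h0, ← Real.rpow_add h0, add_comm γ, hsum, Real.rpow_one]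
  have e2 : (∏ i, min 1 (h i) ^ α) ^ γ = ∏ i, min 1 (h i) ^ (α * γ) := by
    rw [← Real.finsetProd_rpow _ _ fun i _ => Real.rpow_nonneg (hmin i).le _]
    exact Finset.prod_congr rfl fun i _ => (Real.rpow_mul (hmin i).le _ _).symm
  -- Exchanging the products collects, for each `h i`, the weights of the sets containing `i`.
  have e3 : ∏ S : Finset (Fin d), (∏ i ∈ S, h i) ^ w S = ∏ i, h i ^ κ := by
    have : ∀ S : Finset (Fin d), (∏ i ∈ S, h i) ^ w S = ∏ i, if i ∈ S then h i ^ w S else 1 := by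
      intro S
      rw [← Real.finsetProd_rpow _ _ fun i _ => (hh i).le, Finset.prod_ite_mem, Finset.univ_inter]
    rw [Finset.prod_congr rfl fun S _ => this S, Finset.prod_comm]
    refine Finset.prod_congr rfl fun i _ => ?_
    rw [← Finset.prod_filter, ← hκ i, Real.rpow_sum_of_pos (hh i)]
  rw [e2, e3, mul_mul_mul_comm, e1]
  ring

section Fourier

open scoped FourierTransform SchwartzMap ContDiff RealInnerProductSpace

/-! ### Fourier pairs of square integrable functions -/

theorem norm_fourierChar_coe (t : ℝ) : ‖(𝐞 t : ℂ)‖ = 1 := Circle.norm_coe _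

theorem continuous_fourierChar_coe : Continuous fun t : ℝ => (𝐞 t : ℂ) :=
  continuous_subtype_val.comp Real.continuous_fourierChar

theorem fourierChar_coe_add (s t : ℝ) : (𝐞 (s + t) : ℂ) = 𝐞 s * 𝐞 t := by
  rw [AddChar.map_add_eq_mul, Circle.coe_mul]

/-- All derivatives are bounded, so a character times a Schwartz function is again a Schwartz
function. -/
theorem hasTemperateGrowth_fourierChar :
    Function.HasTemperateGrowth fun t : ℝ => (𝐞 t : ℂ) := by
  set c : ℂ := 2 * Real.pi * Complex.I with hc
  have heq : (fun t : ℝ => (𝐞 t : ℂ)) = fun t : ℝ => Complex.exp (c * t) := by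
    ext t
    rw [Real.fourierChar_apply, hc]
    push_cast
    ring_nf
  have hd : ∀ t : ℝ, HasDerivAt (fun t : ℝ => Complex.exp (c * t)) (c * Complex.exp (c * t)) t := by
    intro t
    have h1 : HasDerivAt (fun t : ℝ => c * (t : ℂ)) (c * 1) t :=
      (HasDerivAt.ofReal_comp (hasDerivAt_id t)).const_mul c
    simpa [mul_comm] using h1.cexp
  have hit : ∀ n, iteratedDeriv n (fun t : ℝ => Complex.exp (c * t)) =
      fun t : ℝ => c ^ n * Complex.exp (c * t) := by
    intro n
    induction n with
    | zero => ext t; simp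
    | succ n ih =>
      rw [iteratedDeriv_succ, ih]
      ext t
      rw [((hd t).const_mul (c ^ n)).deriv, pow_succ]
      ring
  refine ⟨?_, fun n => ⟨0, ‖c‖ ^ n, fun t => ?_⟩⟩
  · rw [heq]
    exact Complex.contDiff_exp.comp (contDiff_const.mul Complex.ofRealCLM.contDiff)
  · rw [norm_iteratedFDeriv_eq_norm_iteratedDeriv, heq, hit]
    have := norm_fourierChar_coe t
    rw [congrFun heq t] at this
    simp [this]

/-- `G` is the Fourier transform of the square integrable function `φ` on `ℝ^d`, in the sense of
duality with Schwartz functions. -/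
structure IsFourierPair {d : ℕ} (φ G : (Fin d → ℝ) → ℂ) : Prop where
  memLp_left : MemLp φ 2 volume
  memLp_right : MemLp G 2 volume
  pairing : ∀ ψ : 𝓢(EuclideanSpace ℝ (Fin d), ℂ),
    ∫ ξ, G ξ * ψ (WithLp.toLp 2 ξ) = ∫ x, φ x * (𝓕 ψ) (WithLp.toLp 2 x)

theorem integral_comp_ofLp {d : ℕ} (F : (Fin d → ℝ) → ℂ) :
    ∫ v : EuclideanSpace ℝ (Fin d), F (WithLp.ofLp v) = ∫ x, F x :=
  (EuclideanSpace.volume_preserving_symm_measurableEquiv_toLp (Fin d)).integral_comp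
    (MeasurableEquiv.measurableEmbedding _) F

theorem integral_eq_integral_comp_toLp {d : ℕ} (F : EuclideanSpace ℝ (Fin d) → ℂ) :
    ∫ v, F v = ∫ x : Fin d → ℝ, F (WithLp.toLp 2 x) := by
  rw [← integral_comp_ofLp]

/-- Plancherel, transported from `EuclideanSpace ℝ (Fin d)` along the measure-preserving
identification. -/
theorem exists_isFourierPair {d : ℕ} {φ : (Fin d → ℝ) → ℂ} (hφ : MemLp φ 2 volume) :
    ∃ G, IsFourierPair φ G ∧ eLpNorm G 2 volume = eLpNorm φ 2 volume := by
  have hmp := PiLp.volume_preserving_ofLp (Fin d)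
  have hmp' := PiLp.volume_preserving_toLp (Fin d)
  have hφ' : MemLp (fun v : EuclideanSpace ℝ (Fin d) => φ (WithLp.ofLp v)) 2 volume :=
    hφ.comp_measurePreserving hmp
  set u : Lp ℂ 2 (volume : Measure (EuclideanSpace ℝ (Fin d))) := hφ'.toLp _ with hu
  set U : Lp ℂ 2 (volume : Measure (EuclideanSpace ℝ (Fin d))) := 𝓕 u with hU
  refine ⟨fun ξ => U (WithLp.toLp 2 ξ), ⟨hφ, (Lp.memLp U).comp_measurePreserving hmp', ?_⟩, ?_⟩
  · intro ψ
    have h1 := congrArg (fun T => T ψ) (Lp.fourier_toTemperedDistribution_eq u)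
    simp only [TemperedDistribution.fourier_apply, Lp.toTemperedDistribution_apply] at h1
    have h2 : ∫ v, (𝓕 ψ) v • u v = ∫ v, (𝓕 ψ) v • φ (WithLp.ofLp v) := by
      refine integral_congr_ae ?_
      filter_upwards [hφ'.coeFn_toLp] with v hv
      rw [hu, hv]
    rw [h2, integral_eq_integral_comp_toLp, integral_eq_integral_comp_toLp] at h1
    simp only [smul_eq_mul] at h1
    simp_rw [mul_comm (U _), mul_comm (φ _)]
    exact h1.symm
  · have h1 : eLpNorm (fun ξ => U (WithLp.toLp 2 ξ)) 2 volume = eLpNorm U 2 volume :=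
      eLpNorm_comp_measurePreserving (Lp.aestronglyMeasurable U) hmp'
    have h2 : eLpNorm U 2 volume = eLpNorm u 2 volume := by
      have := Lp.norm_fourier_eq u
      rw [Lp.norm_def, Lp.norm_def, ENNReal.toReal_eq_toReal_iff' (Lp.eLpNorm_ne_top _)
        (Lp.eLpNorm_ne_top _)] at this
      exact this
    have h3 : eLpNorm u 2 volume = eLpNorm φ 2 volume := by
      rw [hu, eLpNorm_congr_ae hφ'.coeFn_toLp]
      exact eLpNorm_comp_measurePreserving hφ.aestronglyMeasurable hmp
    rw [h1, h2, h3]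

theorem ae_eq_of_schwartz_pairing {d : ℕ} {G G' : (Fin d → ℝ) → ℂ}
    (hG : LocallyIntegrable G volume) (hG' : LocallyIntegrable G' volume)
    (h : ∀ ψ : 𝓢(EuclideanSpace ℝ (Fin d), ℂ),
      ∫ ξ, G ξ * ψ (WithLp.toLp 2 ξ) = ∫ ξ, G' ξ * ψ (WithLp.toLp 2 ξ)) : G =ᵐ[volume] G' := by
  refine ae_eq_of_integral_contDiff_smul_eq hG hG' fun g hg hgc => ?_
  have hs : ContDiff ℝ ∞ fun v : EuclideanSpace ℝ (Fin d) => (g (WithLp.ofLp v) : ℂ) :=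
    Complex.ofRealCLM.contDiff.comp (hg.comp (EuclideanSpace.equiv (Fin d) ℝ).contDiff)
  have hc : HasCompactSupport fun v : EuclideanSpace ℝ (Fin d) => (g (WithLp.ofLp v) : ℂ) := by
    have h1 : HasCompactSupport fun v : EuclideanSpace ℝ (Fin d) => g (WithLp.ofLp v) :=
      hgc.comp_homeomorph (EuclideanSpace.equiv (Fin d) ℝ).toHomeomorph
    exact h1.comp_left (g := fun r : ℝ => (r : ℂ)) Complex.ofReal_zero
  have := h (hc.toSchwartzMap hs)
  simpa [mul_comm] using this

theorem IsFourierPair.unique {d : ℕ} {φ φ' G G' : (Fin d → ℝ) → ℂ} (h : IsFourierPair φ G)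
    (h' : IsFourierPair φ' G') (heq : φ = φ') : G =ᵐ[volume] G' := by
  subst heq
  exact ae_eq_of_schwartz_pairing (h.memLp_right.locallyIntegrable (by norm_num))
    (h'.memLp_right.locallyIntegrable (by norm_num)) fun ψ => (h.pairing ψ).trans (h'.pairing ψ).symm

theorem fourier_sub_single {d : ℕ} (ψ ψ' : 𝓢(EuclideanSpace ℝ (Fin d), ℂ)) (j : Fin d) (t : ℝ)
    (hψ : ∀ ξ, ψ' ξ = 𝐞 (t * ξ j) * ψ ξ) (x : Fin d → ℝ) :
    (𝓕 ψ) (WithLp.toLp 2 (x - Pi.single j t)) = (𝓕 ψ') (WithLp.toLp 2 x) := by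
  rw [SchwartzMap.fourier_coe, SchwartzMap.fourier_coe, Real.fourier_eq, Real.fourier_eq]
  congr 1
  ext v
  rw [hψ, Circle.smul_def, Circle.smul_def, smul_eq_mul, smul_eq_mul, ← mul_assoc,
    ← fourierChar_coe_add]
  congr 3
  have : WithLp.toLp 2 (x - Pi.single j t) = WithLp.toLp 2 x - EuclideanSpace.single j t := by
    rfl
  rw [this, inner_sub_right, EuclideanSpace.inner_single_right]
  simp
  ring

/-- By duality: the character is moved onto the test function, where it translates the Fourier
transform, and a change of variables moves the translation onto `φ`. -/
theorem IsFourierPair.sub_translate {d : ℕ} {φ G : (Fin d → ℝ) → ℂ} (h : IsFourierPair φ G)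
    (j : Fin d) (t : ℝ) :
    IsFourierPair (fun x => φ (x + Pi.single j t) - φ x) (fun ξ => (𝐞 (t * ξ j) - 1) * G ξ) := by
  have hmp := measurePreserving_add_right (volume : Measure (Fin d → ℝ)) (Pi.single j t : Fin d → ℝ)
  have hφt : MemLp (fun x => φ (x + (Pi.single j t : Fin d → ℝ))) 2 volume :=
    h.memLp_left.comp_measurePreserving hmp
  have hcont : Continuous fun ξ : Fin d → ℝ => (𝐞 (t * ξ j) : ℂ) - 1 :=
    (continuous_fourierChar_coe.comp (by fun_prop)).sub continuous_const
  have hsch : ∀ ψ : 𝓢(EuclideanSpace ℝ (Fin d), ℂ),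
      MemLp (fun x : Fin d → ℝ => ψ (WithLp.toLp 2 x)) 2 volume := fun ψ =>
    (ψ.memLp 2).comp_measurePreserving (PiLp.volume_preserving_toLp (Fin d))
  refine ⟨hφt.sub h.memLp_left, ?_, fun ψ => ?_⟩
  · refine h.memLp_right.of_le_mul (c := 2)
      (hcont.aestronglyMeasurable.mul h.memLp_right.aestronglyMeasurable) (ae_of_all _ fun ξ => ?_)
    rw [norm_mul]
    gcongr
    refine (norm_sub_le _ _).trans ?_
    rw [norm_fourierChar_coe, norm_one]; norm_num
  · have htg : Function.HasTemperateGrowth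
        fun ξ : EuclideanSpace ℝ (Fin d) => (𝐞 (t * ξ j) : ℂ) := by
      have h1 : Function.HasTemperateGrowth fun ξ : EuclideanSpace ℝ (Fin d) => t * ξ j :=
        (t • EuclideanSpace.proj (𝕜 := ℝ) j : EuclideanSpace ℝ (Fin d) →L[ℝ] ℝ).hasTemperateGrowth
      exact hasTemperateGrowth_fourierChar.comp h1
    set ψ' : 𝓢(EuclideanSpace ℝ (Fin d), ℂ) :=
      SchwartzMap.smulLeftCLM ℂ (fun ξ : EuclideanSpace ℝ (Fin d) => (𝐞 (t * ξ j) : ℂ)) ψ with hψ'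
    have hψ'a : ∀ ξ, ψ' ξ = 𝐞 (t * ξ j) * ψ ξ := fun ξ => by
      rw [hψ', SchwartzMap.smulLeftCLM_apply_apply htg, smul_eq_mul]
    have hL : ∫ ξ, (𝐞 (t * ξ j) - 1) * G ξ * ψ (WithLp.toLp 2 ξ) =
        (∫ ξ, G ξ * ψ' (WithLp.toLp 2 ξ)) - ∫ ξ, G ξ * ψ (WithLp.toLp 2 ξ) := by
      have i1 : ∀ ψ : 𝓢(EuclideanSpace ℝ (Fin d), ℂ),
          Integrable (fun ξ => G ξ * ψ (WithLp.toLp 2 ξ)) volume := fun ψ =>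
        h.memLp_right.integrable_mul (hsch ψ)
      rw [← integral_sub (i1 ψ') (i1 ψ)]
      congr 1
      ext ξ
      rw [hψ'a]
      ring
    have hR : ∫ x, (φ (x + Pi.single j t) - φ x) * (𝓕 ψ) (WithLp.toLp 2 x) =
        (∫ x : Fin d → ℝ, φ (x + Pi.single j t) * (𝓕 ψ) (WithLp.toLp 2 x)) -
          ∫ x, φ x * (𝓕 ψ) (WithLp.toLp 2 x) := by
      have i1 : Integrable (fun x : Fin d → ℝ => φ (x + Pi.single j t) *
          (𝓕 ψ) (WithLp.toLp 2 x)) volume := hφt.integrable_mul (hsch (𝓕 ψ))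
      have i2 : Integrable (fun x => φ x * (𝓕 ψ) (WithLp.toLp 2 x)) volume :=
        h.memLp_left.integrable_mul (hsch (𝓕 ψ))
      rw [← integral_sub i1 i2]
      congr 1
      ext x
      ring
    rw [hL, hR, h.pairing ψ', h.pairing ψ]
    congr 1
    have := hmp.integral_comp (measurableEmbedding_addRight _)
      (fun x => φ x * (𝓕 ψ) (WithLp.toLp 2 (x - Pi.single j t)))
    simp only [add_sub_cancel_right] at this
    rw [this]
    congr 1
    ext x
    rw [fourier_sub_single ψ ψ' j t hψ'a]

/-- The multiplier `∏_{j ∈ S} (e^{2πi h_j ξ_j} - 1)` of the mixed difference `Δ_h^S`. -/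
noncomputable def stepMultiplier {d : ℕ} (h : Fin d → ℝ) (S : Finset (Fin d)) (ξ : Fin d → ℝ) : ℂ :=
  ∏ j ∈ S, ((𝐞 (h j * ξ j) : ℂ) - 1)

theorem continuous_stepMultiplier {d : ℕ} (h : Fin d → ℝ) (S : Finset (Fin d)) :
    Continuous (stepMultiplier h S) :=
  continuous_finsetProd _ fun _ _ =>
    (continuous_fourierChar_coe.comp (by fun_prop)).sub continuous_const

theorem norm_stepMultiplier_le {d : ℕ} (h : Fin d → ℝ) (S : Finset (Fin d)) (ξ : Fin d → ℝ) :
    ‖stepMultiplier h S ξ‖ ≤ 2 ^ S.card := by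
  rw [stepMultiplier, norm_prod]
  rw [← Finset.prod_const]
  refine Finset.prod_le_prod (fun _ _ => norm_nonneg _) fun j _ => ?_
  refine (norm_sub_le _ _).trans ?_
  rw [norm_fourierChar_coe, norm_one]; norm_num

theorem IsFourierPair.stepDiff {d : ℕ} {φ G : (Fin d → ℝ) → ℂ} (hp : IsFourierPair φ G)
    (h : Fin d → ℝ) (S : Finset (Fin d)) :
    IsFourierPair (stepDiff h S φ) (fun ξ => stepMultiplier h S ξ * G ξ) := by
  induction S using Finset.induction_on with
  | empty => simpa [stepDiff_empty, stepMultiplier] using hp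
  | insert j S hj ih =>
    have := ih.sub_translate j (h j)
    have e1 : _root_.stepDiff h (insert j S) φ = fun x => _root_.stepDiff h S φ (x + Pi.single j (h j)) -
      _root_.stepDiff h S φ x := funext fun x => stepDiff_insert h hj φ x
    rw [e1]
    convert this using 2 with ξ
    rw [stepMultiplier, Finset.prod_insert hj, mul_assoc]
    rfl

theorem stepDiff_sub_translate {d : ℕ} (h : Fin d → ℝ) (S : Finset (Fin d)) (f : (Fin d → ℝ) → ℂ)
    (v x : Fin d → ℝ) :
    stepDiff h S (fun y => f (y + v) - f y) x = stepDiff h S f (x + v) - stepDiff h S f x := by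
  induction S using Finset.induction_on generalizing x with
  | empty => simp [stepDiff_empty]
  | insert j S hj ih =>
    simp only [stepDiff_insert h hj, ih]
    rw [add_right_comm]
    ring

theorem stepDiff_comm {d : ℕ} (h k : Fin d → ℝ) (S R : Finset (Fin d)) (f : (Fin d → ℝ) → ℂ) :
    stepDiff h S (stepDiff k R f) = stepDiff k R (stepDiff h S f) := by
  induction S using Finset.induction_on with
  | empty => simp [stepDiff_empty]
  | insert j S hj ih =>
    have e1 : stepDiff h (insert j S) f = fun x => stepDiff h S f (x + Pi.single j (h j)) -
      stepDiff h S f x := funext fun x => stepDiff_insert h hj f x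
    ext x
    rw [e1, stepDiff_sub_translate, stepDiff_insert h hj, ih]

theorem stepDiff_sub {d : ℕ} (h : Fin d → ℝ) (S : Finset (Fin d)) (f g : (Fin d → ℝ) → ℂ)
    (x : Fin d → ℝ) : stepDiff h S (fun y => f y - g y) x = stepDiff h S f x - stepDiff h S g x := by
  induction S using Finset.induction_on generalizing x with
  | empty => simp [stepDiff_empty]
  | insert j S hj ih =>
    simp only [stepDiff_insert h hj, ih]
    ring

/-! ### Absolutely convergent Fourier integrals -/

theorem inner_toLp {d : ℕ} (x y : Fin d → ℝ) :
    ⟪(WithLp.toLp 2 x : EuclideanSpace ℝ (Fin d)), WithLp.toLp 2 y⟫ = ∑ j, x j * y j := by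
  simp [PiLp.inner_apply, mul_comm]

theorem integrable_mul_fourierChar {d : ℕ} {g : (Fin d → ℝ) → ℂ} (hg : Integrable g volume)
    (y : Fin d → ℝ) : Integrable (fun ξ => g ξ * (𝐞 (∑ j, ξ j * y j) : ℂ)) volume := by
  refine hg.mono (hg.aestronglyMeasurable.mul
    (continuous_fourierChar_coe.comp (by fun_prop)).aestronglyMeasurable) (ae_of_all _ fun ξ => ?_)
  rw [norm_mul, norm_fourierChar_coe, mul_one]

theorem continuous_integral_fourierChar {d : ℕ} {g : (Fin d → ℝ) → ℂ} (hg : Integrable g volume) :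
    Continuous fun y : Fin d → ℝ => ∫ ξ, g ξ * (𝐞 (∑ j, ξ j * y j) : ℂ) := by
  refine continuous_of_dominated (bound := fun ξ => ‖g ξ‖)
    (fun y => (integrable_mul_fourierChar hg y).aestronglyMeasurable)
    (fun y => ae_of_all _ fun ξ => ?_) hg.norm (ae_of_all _ fun ξ => ?_)
  · rw [norm_mul, norm_fourierChar_coe, mul_one]
  · exact continuous_const.mul (continuous_fourierChar_coe.comp (by fun_prop))

theorem stepDiff_integral_fourierChar {d : ℕ} {g : (Fin d → ℝ) → ℂ} (hg : Integrable g volume)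
    (h : Fin d → ℝ) (S : Finset (Fin d)) (y : Fin d → ℝ) :
    stepDiff h S (fun y : Fin d → ℝ => ∫ ξ, g ξ * (𝐞 (∑ j, ξ j * y j) : ℂ)) y =
      ∫ ξ, stepMultiplier h S ξ * g ξ * (𝐞 (∑ j, ξ j * y j) : ℂ) := by
  have hint : ∀ S, Integrable (fun ξ => stepMultiplier h S ξ * g ξ) volume := fun S =>
    hg.bdd_mul (continuous_stepMultiplier h S).aestronglyMeasurable
      (ae_of_all _ (norm_stepMultiplier_le h S))
  induction S using Finset.induction_on generalizing y with
  | empty => simp [stepDiff_empty, stepMultiplier]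
  | insert i S hi ih =>
    rw [stepDiff_insert h hi, ih, ih, ← integral_sub (integrable_mul_fourierChar (hint S) _)
      (integrable_mul_fourierChar (hint S) _)]
    congr 1
    ext ξ
    have : ∑ j, ξ j * (y + (Pi.single i (h i) : Fin d → ℝ)) j = ∑ j, ξ j * y j + h i * ξ i := by
      simp [mul_add, Finset.sum_add_distrib, Pi.single_apply, mul_comm]
    rw [this, fourierChar_coe_add, stepMultiplier, stepMultiplier, Finset.prod_insert hi]
    ring

/-- Fubini; it identifies the Fourier integral of `g` by testing against Schwartz functions. -/
theorem integral_fourierChar_mul_schwartz {d : ℕ} {g : (Fin d → ℝ) → ℂ} (hg : Integrable g volume)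
    (χ : 𝓢(EuclideanSpace ℝ (Fin d), ℂ)) :
    ∫ y : Fin d → ℝ, (∫ ξ, g ξ * (𝐞 (∑ j, ξ j * y j) : ℂ)) * χ (WithLp.toLp 2 y) =
      ∫ ξ, g ξ * (𝓕⁻ χ) (WithLp.toLp 2 ξ) := by
  have hχ : Integrable (fun y : Fin d → ℝ => χ (WithLp.toLp 2 y)) volume :=
    (PiLp.volume_preserving_toLp (Fin d)).integrable_comp_of_integrable χ.integrable
  have hinv : ∀ ξ : Fin d → ℝ, (𝓕⁻ χ) (WithLp.toLp 2 ξ) =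
      ∫ y : Fin d → ℝ, (𝐞 (∑ j, ξ j * y j) : ℂ) * χ (WithLp.toLp 2 y) := by
    intro ξ
    rw [SchwartzMap.fourierInv_coe, Real.fourierInv_eq, integral_eq_integral_comp_toLp]
    refine integral_congr_ae (ae_of_all _ fun y => ?_)
    simp only [Circle.smul_def, smul_eq_mul, inner_toLp, mul_comm (y _)]
  simp_rw [hinv, ← integral_const_mul, ← integral_mul_const]
  rw [integral_integral_swap]
  · congr 1
    ext ξ
    congr 1
    ext y
    ring
  · have h1 : Integrable (fun q : (Fin d → ℝ) × (Fin d → ℝ) => χ (WithLp.toLp 2 q.1) * g q.2)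
        (volume.prod volume) := hχ.mul_prod hg
    have hc : Continuous fun q : (Fin d → ℝ) × (Fin d → ℝ) => (𝐞 (∑ j, q.2 j * q.1 j) : ℂ) :=
      continuous_fourierChar_coe.comp (by fun_prop)
    refine (h1.bdd_mul hc.aestronglyMeasurable
      (ae_of_all _ fun q => (norm_fourierChar_coe _).le)).congr (ae_of_all _ fun q => ?_)
    simp only [Function.uncurry]
    ring

theorem tendsto_integral_fourierChar_cocompact {d : ℕ} (g : (Fin d → ℝ) → ℂ) :
    Tendsto (fun y : Fin d → ℝ => ∫ ξ, g ξ * (𝐞 (∑ j, ξ j * y j) : ℂ)) (cocompact (Fin d → ℝ))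
      (𝓝 0) := by
  have h1 := tendsto_integral_exp_inner_smul_cocompact
    (fun v : EuclideanSpace ℝ (Fin d) => g (WithLp.ofLp v))
  -- The sign reconciles the kernel of the Riemann–Lebesgue lemma, `𝐞 (-⟪v, w⟫)`, with the one used
  -- here.
  have h2 : Tendsto (fun y : Fin d → ℝ => (WithLp.toLp 2 (-y) : EuclideanSpace ℝ (Fin d)))
      (cocompact _) (cocompact _) :=
    ((Homeomorph.neg (Fin d → ℝ)).trans
      (EuclideanSpace.equiv (Fin d) ℝ).symm.toHomeomorph).isClosedEmbedding.tendsto_cocompact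
  refine (h1.comp h2).congr fun y => ?_
  simp only [Function.comp]
  rw [integral_eq_integral_comp_toLp]
  congr 1
  ext ξ
  rw [inner_toLp, Circle.smul_def, smul_eq_mul, mul_comm]
  simp

/-- The value at `x` recurs at the points `x + n t e_j`, which leave every compact set. -/
theorem eq_zero_of_periodic_of_tendsto {d : ℕ} {Z : (Fin d → ℝ) → ℂ}
    (hZ : Tendsto Z (cocompact (Fin d → ℝ)) (𝓝 0)) (j : Fin d) {t : ℝ} (ht : t ≠ 0)
    (hper : ∀ x, Z (x + Pi.single j t) = Z x) (x : Fin d → ℝ) : Z x = 0 := by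
  have h1 : ∀ n : ℕ, Z (x + Pi.single j ((n : ℝ) * t)) = Z x := by
    intro n
    induction n with
    | zero => simp
    | succ n ih =>
      have e1 := hper (x + (Pi.single j ((n : ℝ) * t) : Fin d → ℝ))
      rw [ih, add_assoc, ← Pi.single_add] at e1
      rw [← e1]
      push_cast
      rw [add_mul, one_mul]
  have h2 : Tendsto (fun n : ℕ => x + Pi.single j ((n : ℝ) * t)) atTop (cocompact (Fin d → ℝ)) := by
    rw [← Metric.cobounded_eq_cocompact, ← tendsto_norm_atTop_iff_cobounded]
    have h3 : Tendsto (fun n : ℕ => (n : ℝ) * |t| - ‖x‖) atTop atTop :=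
      tendsto_atTop_add_const_right _ _
        (tendsto_natCast_atTop_atTop.atTop_mul_const (abs_pos.2 ht))
    refine tendsto_atTop_mono (fun n => ?_) h3
    have h4 : ‖(Pi.single j ((n : ℝ) * t) : Fin d → ℝ)‖ = n * |t| := by
      rw [Pi.norm_single]; simp
    have h5 := norm_sub_le (x + Pi.single j ((n : ℝ) * t)) x
    rw [add_sub_cancel_left, h4] at h5
    linarith
  have h3 := hZ.comp h2
  exact tendsto_nhds_unique (tendsto_const_nhds.congr fun n => (h1 n).symm) h3

/-- One variable is removed at a time: if the difference in `j` vanishes, the remaining difference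
is `h j`-periodic in `x_j` and tends to 0. -/
theorem eq_zero_of_stepDiff_eq_zero {d : ℕ} {Z : (Fin d → ℝ) → ℂ}
    (hZ : Tendsto Z (cocompact (Fin d → ℝ)) (𝓝 0)) {h : Fin d → ℝ} (hh : ∀ i, h i ≠ 0)
    (S : Finset (Fin d)) (h0 : ∀ x, stepDiff h S Z x = 0) (x : Fin d → ℝ) : Z x = 0 := by
  have htend : ∀ S, Tendsto (stepDiff h S Z) (cocompact (Fin d → ℝ)) (𝓝 0) := by
    intro S
    induction S using Finset.induction_on with
    | empty => rwa [stepDiff_empty]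
    | insert j S hj ih =>
      have h1 := (ih.comp (Homeomorph.addRight (Pi.single j (h j) :
        Fin d → ℝ)).isClosedEmbedding.tendsto_cocompact).sub ih
      rw [sub_zero] at h1
      exact h1.congr fun x => (stepDiff_insert h hj Z x).symm
  induction S using Finset.induction_on with
  | empty => rw [stepDiff_empty] at h0; exact h0 x
  | insert j S hj ih =>
    refine ih (eq_zero_of_periodic_of_tendsto (htend S) j (hh j) fun y => ?_)
    have := h0 y
    rwa [stepDiff_insert h hj, sub_eq_zero] at this

/-- The multiplier vanishes only on the hyperplanes `ξ_j = n`, `n ∈ ℤ`, so dividing by it is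
legitimate almost everywhere. -/
theorem ae_fourierChar_ne_one {d : ℕ} :
    ∀ᵐ ξ : Fin d → ℝ, stepMultiplier 1 Finset.univ ξ ≠ 0 := by
  have h1 : ∀ᵐ ξ : Fin d → ℝ, ∀ (j : Fin d) (n : ℤ), ξ j ≠ n := by
    rw [ae_all_iff]; intro j
    rw [ae_all_iff]; intro n
    have := Measure.pi_hyperplane (fun _ : Fin d => (volume : Measure ℝ)) j (n : ℝ)
    rw [← volume_pi] at this
    exact measure_eq_zero_iff_ae_notMem.1 this
  filter_upwards [h1] with ξ hξ
  rw [stepMultiplier, Finset.prod_ne_zero_iff]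
  intro j _ h0
  rw [sub_eq_zero, Real.fourierChar_apply, Complex.exp_eq_one_iff] at h0
  obtain ⟨n, hn⟩ := h0
  refine hξ j n ?_
  have h2 : ((2 * Real.pi * Complex.I : ℂ)) ≠ 0 := Complex.two_pi_I_ne_zero
  have h3 : ((ξ j : ℂ)) = n := by
    apply mul_left_cancel₀ h2
    rw [mul_comm _ (n : ℂ), ← hn]
    simp
    ring
  exact_mod_cast h3

/-- If `Δ_h f ∈ L_2` and the Fourier transforms of the `Δ_h f` divided by their multipliers give an
integrable function `g`, then `f` is the Fourier integral of `g`. -/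
theorem eq_integral_fourierChar_of_integrable {d : ℕ} {f : (Fin d → ℝ) → ℂ} (hf : InC0 f)
    {g : (Fin d → ℝ) → ℂ} (hg : Integrable g volume)
    (hpair : IsFourierPair (stepDiff 1 Finset.univ f) (fun ξ => stepMultiplier 1 Finset.univ ξ * g ξ))
    (y : Fin d → ℝ) : f y = ∫ ξ, g ξ * (𝐞 (∑ j, ξ j * y j) : ℂ) := by
  set u : (Fin d → ℝ) → ℂ := fun y => ∫ ξ, g ξ * (𝐞 (∑ j, ξ j * y j) : ℂ) with hu
  have hmg : Integrable (fun ξ => stepMultiplier 1 Finset.univ ξ * g ξ) volume :=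
    hg.bdd_mul (continuous_stepMultiplier 1 Finset.univ).aestronglyMeasurable
      (ae_of_all _ (norm_stepMultiplier_le 1 Finset.univ))
  have huc : Continuous u := continuous_integral_fourierChar hg
  have hfc := continuous_stepDiff 1 Finset.univ hf.1
  have hucd := continuous_stepDiff 1 Finset.univ huc
  have hae : stepDiff 1 Finset.univ f =ᵐ[volume] stepDiff 1 Finset.univ u := by
    refine ae_eq_of_schwartz_pairing hfc.locallyIntegrable hucd.locallyIntegrable fun χ => ?_
    -- Testing with `𝓕⁻ χ` turns the right side of the pairing into an integral against `χ` itself.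
    have h1 := hpair.pairing (𝓕⁻ χ)
    rw [FourierTransform.fourier_fourierInv_eq] at h1
    rw [← h1, ← integral_fourierChar_mul_schwartz hmg χ]
    congr 1
    ext x
    rw [hu, stepDiff_integral_fourierChar hg]
  have heq := (Continuous.ae_eq_iff_eq volume hfc hucd).1 hae
  have hZ : Tendsto (fun y => f y - u y) (cocompact (Fin d → ℝ)) (𝓝 0) := by
    simpa using hf.2.sub (tendsto_integral_fourierChar_cocompact g)
  have := eq_zero_of_stepDiff_eq_zero hZ (h := 1) (fun i => by simp) Finset.univ
    (fun x => by rw [stepDiff_sub, heq, sub_self]) y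
  exact sub_eq_zero.1 this

/-- Rescaling by `2π` passes from the kernel `e^{2πi(x,y)}` to `e^{i(x,y)}`. -/
theorem inFourierAlgebra_of_eq_integral_fourierChar {d : ℕ} {f g : (Fin d → ℝ) → ℂ}
    (hg : Integrable g volume) (hfg : ∀ y, f y = ∫ ξ, g ξ * (𝐞 (∑ j, ξ j * y j) : ℂ)) :
    InFourierAlgebra f := by
  have hpi : (2 * Real.pi) ≠ 0 := by positivity
  refine ⟨fun x => (((2 * Real.pi) ^ d)⁻¹ : ℝ) * g ((2 * Real.pi)⁻¹ • x), ?_, fun y => ?_⟩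
  · exact (hg.comp_smul (inv_ne_zero hpi)).const_mul _
  · have h1 := Measure.integral_comp_inv_smul (volume : Measure (Fin d → ℝ))
      (fun ξ => g ξ * (𝐞 (∑ j, ξ j * y j) : ℂ)) (2 * Real.pi)
    rw [← hfg, Module.finrank_fin_fun, abs_of_nonneg (by positivity)] at h1
    have h2 : f y = (((2 * Real.pi) ^ d)⁻¹ : ℝ) * ∫ x : Fin d → ℝ, g ((2 * Real.pi)⁻¹ • x) *
        (𝐞 (∑ j, ((2 * Real.pi)⁻¹ • x) j * y j) : ℂ) := by
      rw [h1, Complex.real_smul, ← mul_assoc, ← Complex.ofReal_mul, inv_mul_cancel₀ (by positivity)]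
      simp
    rw [h2, ← integral_const_mul]
    congr 1
    ext x
    rw [mul_assoc, Real.fourierChar_apply]
    congr 3
    have : 2 * Real.pi * ∑ j, ((2 * Real.pi)⁻¹ • x) j * y j = ∑ j, x j * y j := by
      rw [Finset.mul_sum]
      refine Finset.sum_congr rfl fun j _ => ?_
      simp only [Pi.smul_apply, smul_eq_mul]
      field_simp
    rw [this, mul_comm]

end Fourier

open scoped FourierTransform

/-! ### Dyadic summation -/

theorem ENNReal.tsum_pi_prod {d : ℕ} (a : ℤ → ℝ≥0∞) :
    ∑' s : Fin d → ℤ, ∏ i, a (s i) = (∑' k, a k) ^ d := by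
  induction d with
  | zero => simp
  | succ d ih =>
    rw [← (Fin.consEquiv fun _ : Fin (d + 1) => ℤ).tsum_eq, ENNReal.tsum_prod', pow_succ', ← ih]
    simp only [Fin.consEquiv_apply, Fin.prod_univ_succ, Fin.cons_zero, Fin.cons_succ,
      ENNReal.tsum_mul_left, ENNReal.tsum_mul_right]

/-- Two geometric series: for `k ≥ 0` the minimum is `2^{-k}` and the ratio is `2^{-(κ+β-1/2)}`; for
`k ≤ 0` the minimum is 1 and the ratio in `-k` is `2^{κ-1/2}`. -/
theorem summable_dyadic {κ β : ℝ} (hκ : κ < 1 / 2) (hβ : 1 / 2 < κ + β) :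
    Summable fun k : ℤ => ((2 : ℝ) ^ (-k)) ^ (κ - 1 / 2) * min 1 ((2 : ℝ) ^ (-k)) ^ β := by
  have hpos : ∀ k : ℤ, (0 : ℝ) < 2 ^ k := fun k => zpow_pos (by norm_num) k
  have hpow : ∀ (n : ℕ) (c : ℝ), ((2 : ℝ) ^ n) ^ c = ((2 : ℝ) ^ c) ^ n := fun n c => by
    rw [← Real.rpow_natCast, ← Real.rpow_natCast, ← Real.rpow_mul (by norm_num),
      ← Real.rpow_mul (by norm_num), mul_comm]
  apply Summable.of_nat_of_neg
  · have h1 : Summable fun n : ℕ => ((2 : ℝ) ^ (-(κ + β - 1 / 2))) ^ n :=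
      summable_geometric_of_lt_one (by positivity)
        (Real.rpow_lt_one_of_one_lt_of_neg (by norm_num) (by linarith))
    refine h1.congr fun n => ?_
    have e1 : (2 : ℝ) ^ (-(n : ℤ)) ≤ 1 := by
      rw [zpow_neg, zpow_natCast]
      exact inv_le_one_of_one_le₀ (one_le_pow₀ (by norm_num))
    rw [min_eq_right e1, ← Real.rpow_add (hpos _), zpow_neg, zpow_natCast, Real.inv_rpow (by positivity),
      ← Real.rpow_neg (by positivity), hpow]
    ring_nf
  · have h1 : Summable fun n : ℕ => ((2 : ℝ) ^ (κ - 1 / 2)) ^ n :=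
      summable_geometric_of_lt_one (by positivity)
        (Real.rpow_lt_one_of_one_lt_of_neg (by norm_num) (by linarith))
    refine h1.congr fun n => ?_
    have e1 : (1 : ℝ) ≤ 2 ^ (-(-(n : ℤ))) := by
      rw [neg_neg, zpow_natCast]
      exact one_le_pow₀ (by norm_num)
    rw [min_eq_left e1, Real.one_rpow, mul_one, neg_neg, zpow_natCast, hpow]

/-- In this range `cos 2πt ≤ 0`, so the real part is at most `-1`. -/
theorem one_le_norm_fourierChar_sub_one {t : ℝ} (h1 : 1 / 4 ≤ |t|) (h2 : |t| ≤ 1 / 2) :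
    1 ≤ ‖(𝐞 t : ℂ) - 1‖ := by
  have hcos : Real.cos (2 * Real.pi * t) ≤ 0 := by
    rw [← Real.cos_abs, abs_mul, abs_of_pos Real.two_pi_pos]
    apply Real.cos_nonpos_of_pi_div_two_le_of_le
    · nlinarith [Real.pi_pos]
    · nlinarith [Real.pi_pos]
  have hre : ((𝐞 t : ℂ) - 1).re = Real.cos (2 * Real.pi * t) - 1 := by
    rw [Real.fourierChar_apply, Complex.sub_re, Complex.exp_ofReal_mul_I_re, Complex.one_re]
  have := Complex.abs_re_le_norm ((𝐞 t : ℂ) - 1)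
  rw [hre] at this
  have h3 := neg_abs_le (Real.cos (2 * Real.pi * t) - 1)
  linarith

/-- The dyadic shell `2^{k-2} ≤ |t| < 2^{k-1}`. -/
def dyadicShell (k : ℤ) : Set ℝ := {t | (2 : ℝ) ^ (k - 2) ≤ |t| ∧ |t| < 2 ^ (k - 1)}

theorem measurableSet_dyadicShell (k : ℤ) : MeasurableSet (dyadicShell k) :=
  (measurableSet_le measurable_const measurable_norm).inter
    (measurableSet_lt measurable_norm measurable_const)

theorem volume_dyadicShell_le (k : ℤ) :
    volume (dyadicShell k) ≤ ENNReal.ofReal (((2 : ℝ) ^ (-k))⁻¹) := by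
  have h1 : dyadicShell k ⊆ Icc (-(2 : ℝ) ^ (k - 1)) (2 ^ (k - 1)) := fun t ht =>
    abs_le.1 ht.2.le
  refine (measure_mono h1).trans ?_
  rw [Real.volume_Icc]
  refine ENNReal.ofReal_le_ofReal (le_of_eq ?_)
  rw [zpow_neg, inv_inv, zpow_sub_one₀ (by norm_num)]
  ring

theorem exists_mem_dyadicShell {t : ℝ} (ht : t ≠ 0) : ∃ k, t ∈ dyadicShell k := by
  obtain ⟨n, hn⟩ := exists_mem_Ico_zpow (abs_pos.2 ht) (one_lt_two : (1 : ℝ) < 2)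
  refine ⟨n + 2, ?_, ?_⟩
  · simpa using hn.1
  · have : n + 2 - 1 = n + 1 := by ring
    rw [this]; exact hn.2

/-- The indexing of the shells is chosen so that `1/4 ≤ |h_i ξ_i| ≤ 1/2` for `h_i = 2^{-s_i}`. -/
theorem one_le_norm_stepMultiplier {d : ℕ} {s : Fin d → ℤ} {ξ : Fin d → ℝ}
    (hξ : ∀ i, ξ i ∈ dyadicShell (s i)) :
    1 ≤ ‖stepMultiplier (fun i => (2 : ℝ) ^ (-s i)) Finset.univ ξ‖ := by
  rw [stepMultiplier, norm_prod]
  refine Finset.one_le_prod fun i _ => ?_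
  have hp : (0 : ℝ) < 2 ^ (-s i) := zpow_pos (by norm_num) _
  have habs : |(2 : ℝ) ^ (-s i) * ξ i| = 2 ^ (-s i) * |ξ i| := by rw [abs_mul, abs_of_pos hp]
  have h2 : (2 : ℝ) ≠ 0 := by norm_num
  refine one_le_norm_fourierChar_sub_one ?_ ?_
  · rw [habs]
    calc (1 : ℝ) / 4 = 2 ^ (-s i) * 2 ^ (s i - 2) := by
          rw [← zpow_add₀ h2]; ring_nf; norm_num
      _ ≤ _ := by gcongr; exact (hξ i).1
  · rw [habs]
    calc (2 : ℝ) ^ (-s i) * |ξ i| ≤ 2 ^ (-s i) * 2 ^ (s i - 1) := by gcongr; exact (hξ i).2.le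
      _ = 1 / 2 := by
          rw [← zpow_add₀ h2]; ring_nf; norm_num

theorem ae_exists_mem_dyadicShell {d : ℕ} :
    ∀ᵐ ξ : Fin d → ℝ, ∃ s : Fin d → ℤ, ∀ i, ξ i ∈ dyadicShell (s i) := by
  have h1 : ∀ᵐ ξ : Fin d → ℝ, ∀ j : Fin d, ξ j ≠ 0 := by
    rw [ae_all_iff]; intro j
    have := Measure.pi_hyperplane (fun _ : Fin d => (volume : Measure ℝ)) j (0 : ℝ)
    rw [← volume_pi] at this
    exact measure_eq_zero_iff_ae_notMem.1 this
  filter_upwards [h1] with ξ hξ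
  exact Classical.axiomOfChoice fun i => exists_mem_dyadicShell (hξ i)

/-- Since `Δ_h Δ_1 f = Δ_1 Δ_h f`, uniqueness gives `m_h G₁ = m_1 G` for the multipliers. Thus one
function `G₁ / m_1` serves all steps `h` without a transform of `f`, and `|m_h| ≥ 1` on the shell.
-/
theorem IsFourierPair.norm_div_stepMultiplier_le {d : ℕ} {f G₁ G : (Fin d → ℝ) → ℂ} {s : Fin d → ℤ}
    (h₁ : IsFourierPair (_root_.stepDiff 1 Finset.univ f) G₁)
    (h : IsFourierPair (_root_.stepDiff (fun i => (2 : ℝ) ^ (-s i)) Finset.univ f) G) :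
    ∀ᵐ ξ, (∀ i, ξ i ∈ dyadicShell (s i)) →
      ‖G₁ ξ / stepMultiplier 1 Finset.univ ξ‖ ≤ ‖G ξ‖ := by
  have hu := (h₁.stepDiff (fun i => (2 : ℝ) ^ (-s i)) Finset.univ).unique (h.stepDiff 1 Finset.univ)
    (stepDiff_comm _ _ _ _ f)
  filter_upwards [hu, ae_fourierChar_ne_one] with ξ h1 h2 hξ
  have h3 := one_le_norm_stepMultiplier hξ
  have h4 : stepMultiplier (fun i => (2 : ℝ) ^ (-s i)) Finset.univ ξ *
      (G₁ ξ / stepMultiplier 1 Finset.univ ξ) = G ξ := by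
    rw [mul_div_assoc', h1, mul_div_cancel_left₀ _ h2]
  rw [← h4, norm_mul]
  exact le_mul_of_one_le_left (norm_nonneg _) h3

/-- On each product of shells Cauchy–Schwarz and Plancherel apply with the step `h_i = 2^{-s_i}`
adapted to it. The resulting bounds are products over the coordinates, so their sum over `ℤ^d` is
the `d`-th power of the series in `summable_dyadic`. -/
theorem integrable_div_stepMultiplier {d : ℕ} {f : (Fin d → ℝ) → ℂ} (hf : Continuous f)
    {C κ β : ℝ} (hC : 0 ≤ C) (hκ : κ < 1 / 2) (hβ : 1 / 2 < κ + β)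
    (hbd : ∀ h : Fin d → ℝ, (∀ i, 0 < h i) → eLpNorm' (stepDiff h Finset.univ f) 2 volume ≤
      ENNReal.ofReal (C * ∏ i, (h i ^ κ * min 1 (h i) ^ β)))
    {G₁ : (Fin d → ℝ) → ℂ} (h₁ : IsFourierPair (stepDiff 1 Finset.univ f) G₁) :
    Integrable (fun ξ => G₁ ξ / stepMultiplier 1 Finset.univ ξ) volume := by
  set g := fun ξ => G₁ ξ / stepMultiplier 1 Finset.univ ξ with hg
  set a : ℤ → ℝ≥0∞ := fun k =>
    ENNReal.ofReal (((2 : ℝ) ^ (-k)) ^ (κ - 1 / 2) * min 1 ((2 : ℝ) ^ (-k)) ^ β) with ha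
  have hgm : AEStronglyMeasurable g volume :=
    (h₁.memLp_right.aestronglyMeasurable.aemeasurable.div
      (continuous_stepMultiplier 1 Finset.univ).measurable.aemeasurable).aestronglyMeasurable
  have hpos : ∀ k : ℤ, (0 : ℝ) < 2 ^ (-k) := fun k => zpow_pos (by norm_num) _
  have hpart : ∀ s : Fin d → ℤ, ∫⁻ ξ in univ.pi fun i => dyadicShell (s i), ‖g ξ‖ₑ ≤
      ENNReal.ofReal C * ∏ i, a (s i) := by
    intro s
    set h : Fin d → ℝ := fun i => (2 : ℝ) ^ (-s i) with hh
    have hh0 : ∀ i, 0 < h i := fun i => hpos _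
    have hmem : MemLp (stepDiff h Finset.univ f) 2 volume := by
      refine ⟨(continuous_stepDiff h Finset.univ hf).aestronglyMeasurable, ?_⟩
      rw [eLpNorm_eq_eLpNorm' (by norm_num) (by norm_num)]
      exact (hbd h hh0).trans_lt ENNReal.ofReal_lt_top
    obtain ⟨G, hG, hGn⟩ := exists_isFourierPair hmem
    have hms : MeasurableSet (univ.pi fun i => dyadicShell (s i)) :=
      MeasurableSet.univ_pi fun i => measurableSet_dyadicShell _
    have e1 : ∫⁻ ξ in univ.pi fun i => dyadicShell (s i), ‖g ξ‖ₑ ≤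
        ∫⁻ ξ in univ.pi fun i => dyadicShell (s i), ‖G ξ‖ₑ := by
      refine lintegral_mono_ae ?_
      rw [ae_restrict_iff' hms]
      filter_upwards [h₁.norm_div_stepMultiplier_le hG] with ξ h1 h2
      exact enorm_le_iff_norm_le.2 (h1 fun i => h2 i trivial)
    have e2 := lintegral_box_rpow_le (μ := volume.restrict (univ.pi fun i => dyadicShell (s i)))
      (u := fun ξ => ‖G ξ‖ₑ) hG.memLp_right.aestronglyMeasurable.enorm.restrict (one_le_two (α := ℝ))
    have e3 : (∫⁻ ξ in univ.pi fun i => dyadicShell (s i), ‖G ξ‖ₑ ^ (2 : ℝ)) ^ (1 / (2 : ℝ)) ≤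
        ENNReal.ofReal (C * ∏ i, (h i ^ κ * min 1 (h i) ^ β)) := by
      refine le_trans ?_ (hbd h hh0)
      rw [eLpNorm_eq_eLpNorm' (by norm_num) (by norm_num),
        eLpNorm_eq_eLpNorm' (by norm_num) (by norm_num)] at hGn
      simp only [ENNReal.toReal_ofNat] at hGn
      rw [← hGn, eLpNorm']
      gcongr
      exact Measure.restrict_le_self
    have e4 : (volume.restrict (univ.pi fun i => dyadicShell (s i))) univ ^ (1 - 1 / (2 : ℝ)) ≤
        ∏ i, ENNReal.ofReal (h i ^ (-(1 / 2) : ℝ)) := by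
      rw [Measure.restrict_apply_univ, volume_pi_pi]
      calc (∏ i, volume (dyadicShell (s i))) ^ (1 - 1 / (2 : ℝ))
          ≤ (∏ i, ENNReal.ofReal ((h i)⁻¹)) ^ (1 - 1 / (2 : ℝ)) := by
            gcongr with i
            exact volume_dyadicShell_le (s i)
        _ = _ := by
            rw [← ENNReal.prod_rpow_of_nonneg (by norm_num)]
            refine Finset.prod_congr rfl fun i _ => ?_
            rw [ENNReal.ofReal_rpow_of_pos (inv_pos.2 (hh0 i)), Real.inv_rpow (hh0 i).le,
              ← Real.rpow_neg (hh0 i).le]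
            norm_num
    refine (e1.trans e2).trans ((mul_le_mul' e3 e4).trans (le_of_eq ?_))
    have hm : ∀ i, 0 ≤ min 1 (h i) := fun i => (lt_min one_pos (hh0 i)).le
    rw [ENNReal.ofReal_mul hC, ENNReal.ofReal_prod_of_nonneg (fun i _ =>
      mul_nonneg (Real.rpow_nonneg (hh0 i).le _) (Real.rpow_nonneg (hm i) _)), mul_assoc,
      ← Finset.prod_mul_distrib]
    congr 1
    refine Finset.prod_congr rfl fun i _ => ?_
    rw [← ENNReal.ofReal_mul (mul_nonneg (Real.rpow_nonneg (hh0 i).le _) (Real.rpow_nonneg (hm i) _))]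
    simp only [ha]
    congr 1
    rw [mul_right_comm, ← Real.rpow_add (hh0 i)]
    rfl
  refine ⟨hgm, ?_⟩
  have hcover : ∫⁻ ξ, ‖g ξ‖ₑ = ∫⁻ ξ in ⋃ s : Fin d → ℤ, univ.pi fun i => dyadicShell (s i), ‖g ξ‖ₑ := by
    rw [← setLIntegral_univ]
    refine setLIntegral_congr ?_
    filter_upwards [ae_exists_mem_dyadicShell] with ξ hξ
    obtain ⟨s, hs⟩ := hξ
    exact eq_iff_iff.2 ⟨fun _ => mem_iUnion.2 ⟨s, fun i _ => hs i⟩, fun _ => trivial⟩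
  rw [hasFiniteIntegral_iff_enorm, hcover]
  refine ((lintegral_iUnion_le _ _).trans (ENNReal.tsum_le_tsum hpart)).trans_lt ?_
  rw [ENNReal.tsum_mul_left, ENNReal.tsum_pi_prod]
  refine ENNReal.mul_lt_top ENNReal.ofReal_lt_top (ENNReal.pow_lt_top ?_)
  exact (summable_dyadic hκ hβ).tsum_ofReal_lt_top

/-- A function in `C_0` whose differences `Δ_h f` satisfy
`‖Δ_h f‖_2 ≤ C ∏ h_i^κ min(1, h_i)^β` with `κ < 1/2 < κ + β` belongs to `A(ℝ^d)`. -/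
theorem inFourierAlgebra_of_eLpNorm'_stepDiff_le {d : ℕ} {f : (Fin d → ℝ) → ℂ} (hf : InC0 f)
    {C κ β : ℝ} (hC : 0 ≤ C) (hκ : κ < 1 / 2) (hβ : 1 / 2 < κ + β)
    (hbd : ∀ h : Fin d → ℝ, (∀ i, 0 < h i) → eLpNorm' (stepDiff h Finset.univ f) 2 volume ≤
      ENNReal.ofReal (C * ∏ i, (h i ^ κ * min 1 (h i) ^ β))) :
    InFourierAlgebra f := by
  have hmem : MemLp (stepDiff 1 Finset.univ f) 2 volume := by
    refine ⟨(continuous_stepDiff 1 Finset.univ hf.1).aestronglyMeasurable, ?_⟩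
    rw [eLpNorm_eq_eLpNorm' (by norm_num) (by norm_num)]
    exact (hbd 1 fun i => one_pos).trans_lt ENNReal.ofReal_lt_top
  obtain ⟨G₁, h₁, -⟩ := exists_isFourierPair hmem
  have hg := integrable_div_stepMultiplier hf.1 hC hκ hβ hbd h₁
  have hae : (fun ξ => stepMultiplier 1 Finset.univ ξ * (G₁ ξ / stepMultiplier 1 Finset.univ ξ))
      =ᵐ[volume] G₁ := by
    filter_upwards [ae_fourierChar_ne_one] with ξ hξ
    rw [mul_div_cancel₀ _ hξ]
  have hpair : IsFourierPair (stepDiff 1 Finset.univ f)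
      (fun ξ => stepMultiplier 1 Finset.univ ξ * (G₁ ξ / stepMultiplier 1 Finset.univ ξ)) := by
    refine ⟨h₁.memLp_left, (memLp_congr_ae hae).2 h₁.memLp_right, fun ψ => ?_⟩
    rw [← h₁.pairing ψ]
    refine integral_congr_ae ?_
    filter_upwards [hae] with ξ hξ
    rw [hξ]
  exact inFourierAlgebra_of_eq_integral_fourierChar hg
    (eq_integral_fourierChar_of_integrable hf hg hpair)

/-! ### The theorem -/

theorem inFourierAlgebra_of_memLp_mixedDeriv {d : ℕ} (hd : 1 ≤ d) {f : (Fin d → ℝ) → ℂ}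
    (hf : InC0 f) (hAC : HasLocallyACDerivs f) {p : Finset (Fin d) → ℝ≥0∞}
    (hp : ∀ η, η ≠ ∅ → 1 < p η) (hp0 : 1 ≤ p ∅) (hpt : ∀ η, p η ≠ ∞)
    (hD : ∀ η, MemLp (mixedDeriv η f) (p η) volume)
    (hle : ∑ η ∈ Finset.univ.filter (fun η : Finset (Fin d) => η ≠ ∅), (p η)⁻¹ ≤
      (2 : ℝ≥0∞) ^ (d - 1))
    (hlt : (2 : ℝ≥0∞) ^ (d - 1) < ∑ η : Finset (Fin d), (p η)⁻¹) :
    InFourierAlgebra f := by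
  have hp1 : ∀ η, 1 ≤ p η := fun η => by
    by_cases h : η = ∅
    · exact h ▸ hp0
    · exact (hp η h).le
  have hpz : ∀ η, p η ≠ 0 := fun η => (zero_lt_one.trans_le (hp1 η)).ne'
  have hpr : ∀ η, 1 ≤ (p η).toReal := fun η => by
    rw [← ENNReal.toReal_one]
    exact ENNReal.toReal_mono (hpt η) (hp1 η)
  obtain ⟨M, hM⟩ : ∃ M, ∀ x, ‖f x‖ ≤ M := by
    obtain ⟨C, hC⟩ := (⟨⟨f, hf.1⟩, hf.2⟩ : ZeroAtInftyContinuousMap (Fin d → ℝ) ℂ).toBCF.isBounded_range.exists_norm_le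
    exact ⟨C, fun x => hC _ ⟨x, rfl⟩⟩
  have hbox := integral_mixedDeriv_eq_integral_mixedDiff hf.1 hM hAC
    (fun S => (hD S).locallyIntegrable (hp1 S))
  have hfin : ∀ s : Finset (Finset (Fin d)), ∑ η ∈ s, (p η)⁻¹ =
      ENNReal.ofReal (∑ η ∈ s, ((p η).toReal)⁻¹) := fun s => by
    rw [ENNReal.ofReal_sum_of_nonneg fun η _ => inv_nonneg.2 ENNReal.toReal_nonneg]
    refine Finset.sum_congr rfl fun η _ => ?_
    rw [ENNReal.ofReal_inv_of_pos (by linarith [hpr η]), ENNReal.ofReal_toReal (hpt η)]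
  have htwo : (2 : ℝ≥0∞) ^ (d - 1) = ENNReal.ofReal (2 ^ (d - 1)) := by
    rw [ENNReal.ofReal_pow (by norm_num)]; norm_num
  have hd2 : (2 : ℝ) ^ d = 2 * 2 ^ (d - 1) := by
    rw [← pow_succ', Nat.sub_add_cancel hd]
  have hset : Finset.univ.filter (fun η : Finset (Fin d) => η ≠ ∅) = Finset.univ.erase ∅ := by
    ext η; simp
  rw [hset, hfin, htwo, ENNReal.ofReal_le_ofReal_iff (by positivity)] at hle
  rw [hfin, htwo, ENNReal.ofReal_lt_ofReal_iff_of_nonneg (by positivity),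
    ← Finset.sum_erase_add _ _ (Finset.mem_univ ∅)] at hlt
  obtain ⟨C, κ, β, hC, hκ, hβ, hbd⟩ := exists_eLpNorm'_two_stepDiff_le hf.1 hM
    (G := fun S => mixedDeriv S f) (fun S => (hD S).aestronglyMeasurable) hbox
    (p := fun S => (p S).toReal) hpr
    (fun S hS => by
      rw [← ENNReal.toReal_one]
      exact (ENNReal.toReal_lt_toReal ENNReal.one_ne_top (hpt S)).2 (hp S hS))
    (fun S => by
      rw [← eLpNorm_eq_eLpNorm' (hpz S) (hpt S)]
      exact (hD S).eLpNorm_lt_top)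
    (by rw [hd2]; linarith) (by rw [hd2]; linarith)
  exact inFourierAlgebra_of_eLpNorm'_stepDiff_le hf hC hκ hβ hbd

theorem theorem2p3 (d : ℕ) (hd : 1 ≤ d) (f : (Fin d → ℝ) → ℂ) (hf : InC0 f)
    (hAC : HasLocallyACDerivs f) (p : Finset (Fin d) → ℝ≥0∞)
    (hp : ∀ η, η ≠ ∅ → 1 < p η ∧ p η < ∞)
    (hD : ∀ η, η ≠ ∅ → MemLp (mixedDeriv η f) (p η) volume) :
    -- first form, with `f ∈ L_{p_0}`, `1 ≤ p_0 < ∞`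
    (1 ≤ p ∅ → p ∅ < ∞ → MemLp f (p ∅) volume →
        (2 : ℝ≥0∞) ^ (d - 1) < ∑ η : Finset (Fin d), (p η)⁻¹ →
        ∑ η ∈ Finset.univ.filter (fun η : Finset (Fin d) => η ≠ ∅), (p η)⁻¹ ≤ (2 : ℝ≥0∞) ^ (d - 1) →
        InFourierAlgebra f) ∧
    -- equivalent form, with `f ∈ L_q`, `1 ≤ q < p_0 ≤ ∞`
    (∀ q : ℝ≥0∞, 1 ≤ q → q < p ∅ → MemLp f q volume →
        ∑ η : Finset (Fin d), (p η)⁻¹ = (2 : ℝ≥0∞) ^ (d - 1) →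
        InFourierAlgebra f) := by
  have hset : Finset.univ.filter (fun η : Finset (Fin d) => η ≠ ∅) = Finset.univ.erase ∅ := by
    ext η; simp
  constructor
  · intro hp0 hpt hfp hlt hle
    refine inFourierAlgebra_of_memLp_mixedDeriv hd hf hAC (fun η h => (hp η h).1) hp0
      (fun η => ?_) (fun η => ?_) hle hlt
    · by_cases h : η = ∅
      · exact h ▸ hpt.ne
      · exact (hp η h).2.ne
    · by_cases h : η = ∅
      · rw [h, mixedDeriv_empty]; exact hfp
      · exact hD η h
  · intro q hq hqp hfq hsum
    have hupd : ∀ η, η ≠ ∅ → Function.update p ∅ q η = p η := fun η h => Function.update_of_ne h _ _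
    have herase : ∑ η ∈ Finset.univ.erase ∅, (Function.update p ∅ q η)⁻¹ =
        ∑ η ∈ Finset.univ.erase ∅, (p η)⁻¹ :=
      Finset.sum_congr rfl fun η h => by rw [hupd η (Finset.ne_of_mem_erase h)]
    have hsplit := hsum
    rw [← Finset.sum_erase_add _ _ (Finset.mem_univ ∅)] at hsplit
    have hle : ∑ η ∈ Finset.univ.erase ∅, (p η)⁻¹ ≤ (2 : ℝ≥0∞) ^ (d - 1) :=
      hsplit ▸ le_self_add
    -- Replacing `p ∅` by the smaller, hence finite, exponent `q` turns the equality of the sums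
    -- into the strict inequality of the first form.
    refine inFourierAlgebra_of_memLp_mixedDeriv hd hf hAC (p := Function.update p ∅ q)
      (fun η h => ?_) ?_ (fun η => ?_) (fun η => ?_) ?_ ?_
    · rw [hupd η h]; exact (hp η h).1
    · rwa [Function.update_self]
    · by_cases h : η = ∅
      · rw [h, Function.update_self]; exact hqp.ne_top
      · rw [hupd η h]; exact (hp η h).2.ne
    · by_cases h : η = ∅
      · rw [h, Function.update_self, mixedDeriv_empty]; exact hfq
      · rw [hupd η h]; exact hD η h
    · rw [hset, herase]; exact hle
    · rw [← Finset.sum_erase_add _ _ (Finset.mem_univ ∅), herase, Function.update_self, ← hsplit]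
      exact ENNReal.add_lt_add_left (ne_top_of_le_ne_top (by simp) hle) (ENNReal.inv_lt_inv.2 hqp)
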